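/- Let $n\ge 0$ and let $\prec$ be a local order on the monomials $X^\alpha=x_1^{\alpha_1}\cdots x_n^{\alpha_n}$, $\alpha\in\mathbb Z_{\ge0}^n$, that is, a strict total order such that $X^\alpha\prec X^\beta$ implies $X^{\alpha+\gamma}\prec X^{\beta+\gamma}$, and $x_i\prec 1$ for all $i$; put $0\prec X^\alpha$ for all $\alpha$. Let $\mathcal R$ be either the ring $\mathscr E$ of germs at the origin of smooth functions $\mathbb R^n\to\mathbb R$ (with $K=\mathbb R$), or the ring $K[[x_1,\dots,x_n]]$ of formal power series over a field $K$ of characteristic zero. For $f\in\mathcal R$ let $J^\infty(f)=\sum_\alpha a_\alpha X^\alpha$ be its Taylor series at the origin (the series itself if $\mathcal R=K[[x_1,\dots,x_n]]$). Call $f$ flat if $J^\infty(f)=0$. The terms of $f$ are the $a_\alpha X^\alpha$ with $a_\alpha\ne0$. The leading term $LT(f)$ is the term of $f$ whose monomial $LM(f)$ is greatest for $\prec$, and $LT(f)=0$ if $f$ is flat; terms are compared through their monomials. Let $G=\{g_1,\dots,g_m\}\subset\mathcal R$ be finite. * A remainder of $f\in\mathcal R$ with respect to $G$ is an element $r\in\mathcal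 R$ such that $r=f-\sum_{i=1}^m q_ig_i$ for some $q_i\in\mathcal R$ with $LT(q_ig_i)\preceq LT(f)$ for all $i$, and such that no term of $r$ is divisible by any $LT(g_i)$. * $G$ is a standard basis if the ideal of $\mathcal R$ generated by $\{LT(h): h\in\langle G\rangle_{\mathcal R}\}$ equals $\langle LT(g_1),\dots,LT(g_m)\rangle_{\mathcal R}$. * The S-germ of $f,g\in\mathcal R$ is $S(f,g)=\frac{L}{LT(f)}f-\frac{L}{LT(g)}g$ with $L=\mathrm{LCM}(LM(f),LM(g))$ if neither $f$ nor $g$ is flat, and $S(f,g)=0$ otherwise. Then: (a) Every $f\in\mathcal R$ has a remainder with respect to $G$. (b) $G$ is a standard basis if and only if, for every $f\in\mathcal R$, any two remainders of $f$ with respect to $G$ differ by a flat element. (c) (Buchberger's criterion) $G$ is a standard basis if and only if, for all $i,j$, every remainder of $S(g_i,g_j)$ with respect to $G$ is flat; equivalently, if and only if, for all $i,j$, some remainder of $S(g_i,g_j)$ with respect to $G$ is flat. (d) $G$ is a standard basis if and only if, for every $f\in\langle G\rangle_{\mathcal R}$, every remainder of $f$ with respect to $G$ is flat; equivalently, if and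 only if every $f\in\langle G\rangle_{\mathcal R}$ has a flat remainder with respect to $G$. -/

import Mathlib

open Filter Topology
open scoped ContDiff

noncomputable section

namespace GermDivision

/-- A local order: a strict total order `≺` on the monomials `X^α`, `α ∈ ℕⁿ` (identified with
their exponents), compatible with multiplication and such that every variable is `≺ 1`. -/
structure LocalOrder (n : ℕ) where
  /-- `lt α β` means `X^α ≺ X^β`. -/
  lt : (Fin n →₀ ℕ) → (Fin n →₀ ℕ) → Prop
  irrefl : ∀ α, ¬ lt α α
  trans : ∀ α β γ, lt α β → lt β γ → lt α γ
  total : ∀ α β, lt α β ∨ α = β ∨ lt β α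
  add_right : ∀ α β γ, lt α β → lt (α + γ) (β + γ)
  var_lt_one : ∀ i, lt (Finsupp.single i 1) 0

/-- The order `≼` on monomials, extended by a bottom element that stands for `0`
(so that `0 ≺ X^α` for all `α`). -/
def LocalOrder.le {n : ℕ} (ord : LocalOrder n) :
    WithBot (Fin n →₀ ℕ) → WithBot (Fin n →₀ ℕ) → Prop
  | none, _ => True
  | some _, none => False
  | some α, some β => α = β ∨ ord.lt α β

/-- `α` is the exponent of the greatest monomial occurring in the power series `p`. -/
def LocalOrder.IsLeadExp {n : ℕ} (ord : LocalOrder n) {K : Type*} [Field K]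
    (p : MvPowerSeries (Fin n) K) (α : Fin n →₀ ℕ) : Prop :=
  MvPowerSeries.coeff α p ≠ 0 ∧
    ∀ β, MvPowerSeries.coeff β p ≠ 0 → β ≠ α → ord.lt β α

/-- By Dickson's lemma, every nonzero power series has a leading exponent. -/
theorem LocalOrder.exists_isLeadExp {n : ℕ} (ord : LocalOrder n) {K : Type*} [Field K]
    (p : MvPowerSeries (Fin n) K) (hp : p ≠ 0) : ∃ α, ord.IsLeadExp p α := by
  have hneg : ∀ γ : Fin n →₀ ℕ, γ = 0 ∨ ord.lt γ 0 := by
    intro γ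
    induction γ using Finsupp.induction_linear with
    | zero => exact Or.inl rfl
    | add a b ha hb =>
      rcases ha with rfl | ha
      · simpa using hb
      · rcases hb with rfl | hb
        · simpa using Or.inr ha
        · right
          have h := ord.add_right a 0 b ha
          rw [zero_add] at h
          exact ord.trans _ _ _ h hb
    | single i k =>
      induction k with
      | zero => left; simp
      | succ k ih =>
        right
        have h := ord.add_right _ _ (Finsupp.single i k) (ord.var_lt_one i)
        rw [zero_add, ← Finsupp.single_add, add_comm] at h
        rcases ih with ih | ih
        · rw [ih] at h; exact h
        · exact ord.trans _ _ _ h ih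
  have hwf : WellFounded (fun a b : Fin n →₀ ℕ => ord.lt b a) := by
    rw [wellFounded_iff_isEmpty_descending_chain]
    refine ⟨fun ⟨f, hf⟩ => ?_⟩
    obtain ⟨i, j, hij, hle⟩ := wellQuasiOrdered_le (α := Fin n →₀ ℕ) f
    have h1 : ∀ k l, k < l → ord.lt (f k) (f l) := by
      intro k l hkl
      induction l, hkl using Nat.le_induction with
      | base => exact hf k
      | succ l _ ih => exact ord.trans _ _ _ ih (hf l)
    have h2 := h1 i j hij
    obtain ⟨c, hc⟩ := exists_add_of_le hle
    rcases hneg c with h0 | h0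
    · rw [hc, h0, add_zero] at h2
      exact ord.irrefl _ h2
    · have h3 := ord.add_right c 0 (f i) h0
      rw [zero_add, add_comm, ← hc] at h3
      exact ord.irrefl _ (ord.trans _ _ _ h2 h3)
  have hne : {α | MvPowerSeries.coeff α p ≠ 0}.Nonempty := by
    by_contra h
    rw [Set.not_nonempty_iff_eq_empty] at h
    refine hp (MvPowerSeries.ext fun α => ?_)
    by_contra hα
    exact (Set.eq_empty_iff_forall_notMem.mp h) α (by simpa using hα)
  refine ⟨hwf.min _ hne, hwf.min_mem _ hne, fun β hβ hβ' => ?_⟩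
  rcases ord.total β (hwf.min _ hne) with h | h | h
  · exact h
  · exact absurd h hβ'
  · exact absurd h (hwf.not_lt_min _ hβ)

open Classical in
/-- The exponent of the leading monomial of a power series, `⊥` for the zero series. -/
def LocalOrder.leadExp {n : ℕ} (ord : LocalOrder n) {K : Type*} [Field K]
    (p : MvPowerSeries (Fin n) K) : WithBot (Fin n →₀ ℕ) :=
  if h : p ≠ 0 then ((ord.exists_isLeadExp p h).choose : Fin n →₀ ℕ) else ⊥

/-! ### Leading terms, remainders, standard bases

The same definitions apply to smooth germs and to formal power series; the two rings enter through
their infinite jet and their terms `c X^α`. -/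

/-- The infinite jet of the elements of `R` and the terms `c X^α` in `R`. -/
structure JetData (n : ℕ) (K R : Type*) [Field K] where
  jet : R → MvPowerSeries (Fin n) K
  term : (Fin n →₀ ℕ) → K → R

namespace JetData

variable {n : ℕ} {K R : Type*} [Field K] [CommRing R] (T : JetData n K R) (ord : LocalOrder n)

/-- `f` is flat if its infinite jet vanishes. -/
def Flat (f : R) : Prop := T.jet f = 0

/-- The set of the terms of `f`. -/
def terms (f : R) : Set R :=
  {t | ∃ α, MvPowerSeries.coeff α (T.jet f) ≠ 0 ∧
    t = T.term α (MvPowerSeries.coeff α (T.jet f))}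

/-- The leading term of `f`; it is `0` for flat `f`. -/
def LT (f : R) : R :=
  match ord.leadExp (T.jet f) with
  | none => 0
  | some α => T.term α (MvPowerSeries.coeff α (T.jet f))

/-- `r` is a remainder of `f` with respect to `g₁, …, gₘ`. -/
def IsRemainder {m : ℕ} (g : Fin m → R) (f r : R) : Prop :=
  (∃ q : Fin m → R, r = f - ∑ i, q i * g i ∧
    ∀ i, ord.le (ord.leadExp (T.jet (q i * g i))) (ord.leadExp (T.jet f))) ∧
  ∀ i, ∀ t ∈ T.terms r, ¬ T.LT ord (g i) ∣ t

/-- The ideal of `R` generated by the leading terms of the elements of `I`. -/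
def LTIdeal (I : Ideal R) : Ideal R := Ideal.span (T.LT ord '' (I : Set R))

/-- `{g₁, …, gₘ}` is a standard basis (of the ideal that it generates). -/
def IsStandardBasis {m : ℕ} (g : Fin m → R) : Prop :=
  T.LTIdeal ord (Ideal.span (Set.range g)) = Ideal.span (Set.range fun i => T.LT ord (g i))

/-- The S-germ `(L / LT(f)) f - (L / LT(g)) g`, where `L = lcm(LM(f), LM(g))`; it is `0` if `f` or
`g` is flat. The least common multiple of `X^α` and `X^β` is `X^(α ⊔ β)`. -/
def SGerm (f g : R) : R :=
  match ord.leadExp (T.jet f), ord.leadExp (T.jet g) with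
  | some α, some β =>
      T.term (α ⊔ β - α) (MvPowerSeries.coeff α (T.jet f))⁻¹ * f -
        T.term (α ⊔ β - β) (MvPowerSeries.coeff β (T.jet g))⁻¹ * g
  | _, _ => 0

end JetData

/-! ### Formal power series -/

/-- A formal power series is its own jet. -/
def formalJet (n : ℕ) (K : Type*) [Field K] : JetData n K (MvPowerSeries (Fin n) K) where
  jet p := p
  term α c := MvPowerSeries.monomial α c

/-! ### Smooth germs -/

/-- The ring of germs at the origin of functions `ℝⁿ → ℝ` that are smooth near the origin. -/
def smoothGerms (n : ℕ) : Subring (Germ (𝓝 (0 : Fin n → ℝ)) ℝ) where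
  carrier := {φ | ∃ f : (Fin n → ℝ) → ℝ, (∀ᶠ y in 𝓝 0, ContDiffAt ℝ ∞ f y) ∧ (f : Germ _ ℝ) = φ}
  mul_mem' := by
    rintro _ _ ⟨f, hf, rfl⟩ ⟨g, hg, rfl⟩
    exact ⟨f * g, by filter_upwards [hf, hg] with y h1 h2 using h1.mul h2, rfl⟩
  one_mem' := ⟨fun _ => 1, Eventually.of_forall fun _ => contDiffAt_const, rfl⟩
  add_mem' := by
    rintro _ _ ⟨f, hf, rfl⟩ ⟨g, hg, rfl⟩
    exact ⟨f + g, by filter_upwards [hf, hg] with y h1 h2 using h1.add h2, rfl⟩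
  zero_mem' := ⟨fun _ => 0, Eventually.of_forall fun _ => contDiffAt_const, rfl⟩
  neg_mem' := by
    rintro _ ⟨f, hf, rfl⟩
    exact ⟨-f, by filter_upwards [hf] with y h1 using h1.neg, rfl⟩

/-- The partial derivative `∂f/∂xᵢ`. -/
def partialDeriv {n : ℕ} (i : Fin n) (f : (Fin n → ℝ) → ℝ) : (Fin n → ℝ) → ℝ :=
  fun y => fderiv ℝ f y (Pi.single i 1)

/-- The partial derivative `∂₁^{α₁} ⋯ ∂ₙ^{αₙ} f`. -/
def multiDeriv {n : ℕ} (α : Fin n →₀ ℕ) (f : (Fin n → ℝ) → ℝ) : (Fin n → ℝ) → ℝ :=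
  (List.finRange n).foldr (fun i h => (partialDeriv i)^[α i] h) f

/-- The Taylor series at the origin: the coefficient of `X^α` is `∂^α f (0) / α!`. -/
def taylorSeries {n : ℕ} (f : (Fin n → ℝ) → ℝ) : MvPowerSeries (Fin n) ℝ :=
  fun α => multiDeriv α f 0 / (∏ i, (α i).factorial : ℕ)

theorem multiDeriv_congr {n : ℕ} (α : Fin n →₀ ℕ) {f g : (Fin n → ℝ) → ℝ} (h : f =ᶠ[𝓝 0] g) :
    multiDeriv α f =ᶠ[𝓝 0] multiDeriv α g := by
  have h1 : ∀ (i : Fin n) (u v : (Fin n → ℝ) → ℝ), u =ᶠ[𝓝 0] v →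
      partialDeriv i u =ᶠ[𝓝 0] partialDeriv i v := by
    intro i u v huv
    filter_upwards [huv.fderiv (𝕜 := ℝ)] with y hy
    simp only [partialDeriv, hy]
  have h2 : ∀ (i : Fin n) (k : ℕ) (u v : (Fin n → ℝ) → ℝ), u =ᶠ[𝓝 0] v →
      (partialDeriv i)^[k] u =ᶠ[𝓝 0] (partialDeriv i)^[k] v := by
    intro i k
    induction k with
    | zero => intro u v huv; exact huv
    | succ k ih => intro u v huv; exact ih _ _ (h1 i u v huv)
  unfold multiDeriv
  induction List.finRange n with
  | nil => exact h
  | cons i l ih => exact h2 i _ _ _ ih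

/-- The Taylor series of a germ at the origin. -/
def germJet {n : ℕ} (φ : Germ (𝓝 (0 : Fin n → ℝ)) ℝ) : MvPowerSeries (Fin n) ℝ :=
  φ.liftOn taylorSeries fun f g h => by
    funext α
    simp only [taylorSeries, (multiDeriv_congr α h).self_of_nhds]

/-- Smooth germs, with their Taylor series at the origin and the germs of the functions
`y ↦ c y₁^{α₁} ⋯ yₙ^{αₙ}`. -/
def smoothJet (n : ℕ) : JetData n ℝ (smoothGerms n) where
  jet φ := germJet φ.1
  term α c := ⟨((fun y : Fin n → ℝ => c * ∏ i, y i ^ α i) : Germ _ ℝ),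
    ⟨_, Eventually.of_forall fun _ => by fun_prop, rfl⟩⟩

end GermDivision

end

open GermDivision

/-! All the notions involved depend on an element only through its jet, apart from divisibility by
leading terms, and that reduces to divisibility of exponents. It therefore suffices that the jet is
a surjective ring homomorphism onto formal power series which sends terms to monomials (`IsJetHom`).
This is immediate for formal series; for smooth germs, multiplicativity is the Leibniz rule and
surjectivity is Borel's lemma. Quotients found for jets then lift to the ring, with only flat
errors.

The formal part rests on division in a free module (`exists_formal_division`). The opposite of the
order is well-founded, so the coefficients of quotients and remainder can be determined recursively,
from the greatest monomial downwards. In rank one this gives the existence of remainders.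

For Buchberger's criterion (`exists_le_of_isLeadExp_sum`), small representations of the S-series are
syzygies of the generators. Dividing a coefficient vector `q` by these syzygies, for the Schreyer
order, does not change `∑ q k * g k`, but afterwards the greatest product of leading monomials
cannot cancel. Hence the leading exponent of the sum is a multiple of that of a generator.

Conversely, a nonflat remainder of an element of the ideal would have a leading monomial that a
standard basis divides. Uniqueness of remainders gives back the S-germ criterion because `S(f, g)`
is a difference of two multiples with the same leading monomial: the first multiple has remainder
`0` and also every remainder of the S-germ. -/

namespace GermDivision

/-! ### Division in free modules over formal power series -/

open Classical in
/-- Hironaka division in a free module over the ring of formal power series, for a monomial order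
whose opposite is well-founded. -/
theorem exists_formal_division {n : ℕ} {K σ ι : Type*} [Field K] [Fintype ι]
    (gt : σ × (Fin n →₀ ℕ) → σ × (Fin n →₀ ℕ) → Prop) (wf : WellFounded gt)
    (htrans : ∀ p q r, gt p q → gt q r → gt p r)
    (hadd : ∀ s a t b c, gt (s, a) (t, b) → gt (s, a + c) (t, b + c))
    (G : ι → σ → MvPowerSeries (Fin n) K) (s : ι → σ) (α : ι → Fin n →₀ ℕ)
    (h0 : ∀ i, MvPowerSeries.coeff (α i) (G i (s i)) ≠ 0)
    (hlt : ∀ i t b, MvPowerSeries.coeff b (G i t) ≠ 0 →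
      (s i, α i) = (t, b) ∨ gt (s i, α i) (t, b))
    (F : σ → MvPowerSeries (Fin n) K) :
    ∃ (q : ι → MvPowerSeries (Fin n) K) (r : σ → MvPowerSeries (Fin n) K),
      (∀ t, F t = ∑ i, q i * G i t + r t) ∧
      (∀ t b, MvPowerSeries.coeff b (r t) ≠ 0 → ∀ i, s i = t → ¬ α i ≤ b) ∧
      ∀ i a, MvPowerSeries.coeff a (q i) ≠ 0 → ∃ p : σ × (Fin n →₀ ℕ),
        MvPowerSeries.coeff p.2 (F p.1) ≠ 0 ∧ (p = (s i, a + α i) ∨ gt p (s i, a + α i)) := by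
  have hirr : ∀ p, ¬ gt p p := fun p hp => wf.irrefl.irrefl p hp
  -- Each position is assigned to one generator whose leading position divides it, if there is any;
  -- a choice is needed since several may.
  obtain ⟨slot, hslot1, hslot2⟩ : ∃ slot : σ × (Fin n →₀ ℕ) → Option ι,
      (∀ p, slot p = none → ∀ i, s i = p.1 → ¬ α i ≤ p.2) ∧
      (∀ p i, slot p = some i → s i = p.1 ∧ α i ≤ p.2) := by
    refine ⟨fun p => if h : ∃ i, s i = p.1 ∧ α i ≤ p.2 then some h.choose else none, ?_, ?_⟩
    · intro p hp i hi hle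
      have h : ∃ i, s i = p.1 ∧ α i ≤ p.2 := ⟨i, hi, hle⟩
      simp only [dif_pos h] at hp
      cases hp
    · intro p i hp
      by_cases h : ∃ i, s i = p.1 ∧ α i ≤ p.2
      · simp only [dif_pos h, Option.some.injEq] at hp
        exact hp ▸ h.choose_spec
      · simp only [dif_neg h] at hp
        cases hp
  let lc : ι → K := fun i => MvPowerSeries.coeff (α i) (G i (s i))
  -- `u p` is the coefficient left at `p` once the multiples of generators chosen at greater
  -- positions are subtracted. The guard `gt` makes this a recursion along `wf`.
  obtain ⟨u, hu⟩ : ∃ u : σ × (Fin n →₀ ℕ) → K, ∀ p, u p = MvPowerSeries.coeff p.2 (F p.1) -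
      ∑ i, ∑ x ∈ Finset.HasAntidiagonal.antidiagonal p.2, if gt (s i, x.1 + α i) p then
        (if slot (s i, x.1 + α i) = some i then u (s i, x.1 + α i) / lc i else 0) *
          MvPowerSeries.coeff x.2 (G i p.1) else 0 := by
    refine ⟨wf.fix fun p ih => MvPowerSeries.coeff p.2 (F p.1) -
      ∑ i, ∑ x ∈ Finset.HasAntidiagonal.antidiagonal p.2, if h : gt (s i, x.1 + α i) p then
        (if slot (s i, x.1 + α i) = some i then ih (s i, x.1 + α i) h / lc i else 0) *
          MvPowerSeries.coeff x.2 (G i p.1) else 0, fun p => ?_⟩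
    rw [wf.fix_eq]
    simp only [dite_eq_ite]
  let q : ι → MvPowerSeries (Fin n) K := fun i a =>
    if slot (s i, a + α i) = some i then u (s i, a + α i) / lc i else 0
  let r : σ → MvPowerSeries (Fin n) K := fun t b => if slot (t, b) = none then u (t, b) else 0
  have hq : ∀ i a, MvPowerSeries.coeff a (q i) =
    if slot (s i, a + α i) = some i then u (s i, a + α i) / lc i else 0 := fun _ _ => rfl
  have hr : ∀ t b, MvPowerSeries.coeff b (r t) = if slot (t, b) = none then u (t, b) else 0 :=
    fun _ _ => rfl
  refine ⟨q, r, ?_, ?_, ?_⟩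
  · intro t
    ext β
    -- Without contributions from greater positions, only the leading coefficient of `G i` can
    -- contribute at `(t, β)`: any other coefficient of `G i` lies below its leading position, and
    -- shifting preserves this. What is left is `u (t, β)` or `0`, according to `slot`.
    have key : ∀ i, ∑ x ∈ Finset.HasAntidiagonal.antidiagonal β, (if gt (s i, x.1 + α i) (t, β) then 0 else
        MvPowerSeries.coeff x.1 (q i) * MvPowerSeries.coeff x.2 (G i t)) =
        if slot (t, β) = some i then u (t, β) else 0 := by
      intro i
      have hz : ∀ x ∈ Finset.HasAntidiagonal.antidiagonal β, ¬ (s i = t ∧ x.2 = α i) →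
          (if gt (s i, x.1 + α i) (t, β) then 0 else
          MvPowerSeries.coeff x.1 (q i) * MvPowerSeries.coeff x.2 (G i t)) = 0 := by
        intro x hx hne
        split_ifs with hgt
        · rfl
        by_contra h
        rcases hlt i t x.2 (right_ne_zero_of_mul h) with h1 | h1
        · rw [Prod.mk.injEq] at h1
          exact hne ⟨h1.1, h1.2.symm⟩
        · have := hadd _ _ _ _ x.1 h1
          rw [add_comm (α i), add_comm x.2, Finset.HasAntidiagonal.mem_antidiagonal.mp hx] at this
          exact hgt this
      split_ifs with hs
      · obtain ⟨h1, h2⟩ := hslot2 _ _ hs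
        obtain ⟨c, rfl⟩ := exists_add_of_le h2
        simp only at h1
        rw [Finset.sum_eq_single (c, α i)]
        · subst h1
          simp only [hq]
          rw [add_comm c, if_neg (hirr _), if_pos hs, div_mul_cancel₀ _ (h0 i)]
        · intro x hx hne
          refine hz x hx fun h => hne ?_
          rw [Finset.HasAntidiagonal.mem_antidiagonal, h.2, add_comm] at hx
          exact Prod.ext (add_left_cancel hx) h.2
        · intro h
          exact absurd (Finset.HasAntidiagonal.mem_antidiagonal.mpr (add_comm _ _)) h
      · refine Finset.sum_eq_zero fun x hx => ?_
        by_cases hne : s i = t ∧ x.2 = α i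
        · split_ifs
          · rfl
          rw [Finset.HasAntidiagonal.mem_antidiagonal, hne.2] at hx
          rw [hq, hx, hne.1, if_neg hs, zero_mul]
        · exact hz x hx hne
    have hur : (∑ i, if slot (t, β) = some i then u (t, β) else 0) +
        MvPowerSeries.coeff β (r t) = u (t, β) := by
      rw [hr]
      rcases slot (t, β) with _ | i
      · simp
      · simp
    have hsplit : ∀ i, MvPowerSeries.coeff β (q i * G i t) =
        (∑ x ∈ Finset.HasAntidiagonal.antidiagonal β, if gt (s i, x.1 + α i) (t, β) then
          (if slot (s i, x.1 + α i) = some i then u (s i, x.1 + α i) / lc i else 0) *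
            MvPowerSeries.coeff x.2 (G i t) else 0) +
        if slot (t, β) = some i then u (t, β) else 0 := by
      intro i
      rw [MvPowerSeries.coeff_mul, ← key i, ← Finset.sum_add_distrib]
      refine Finset.sum_congr rfl fun x _ => ?_
      by_cases h : gt (s i, x.1 + α i) (t, β)
      · rw [if_pos h, if_pos h, add_zero, hq]
      · rw [if_neg h, if_neg h, zero_add]
    rw [map_add, map_sum, Finset.sum_congr rfl fun i _ => hsplit i, Finset.sum_add_distrib,
      add_assoc, hur, hu (t, β)]
    ring
  · intro t b hb i hi
    rw [hr] at hb
    by_cases hs : slot (t, b) = none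
    · exact hslot1 _ hs i hi
    · rw [if_neg hs] at hb
      exact absurd rfl hb
  · have hup : ∀ p, u p ≠ 0 → ∃ p' : σ × (Fin n →₀ ℕ),
        MvPowerSeries.coeff p'.2 (F p'.1) ≠ 0 ∧ (p' = p ∨ gt p' p) := by
      intro p
      induction p using wf.induction with
      | _ p ih =>
      intro hp
      by_cases hF : MvPowerSeries.coeff p.2 (F p.1) = 0
      · rw [hu, hF, zero_sub, neg_ne_zero] at hp
        obtain ⟨i, -, hi⟩ := Finset.exists_ne_zero_of_sum_ne_zero hp
        obtain ⟨x, -, hx⟩ := Finset.exists_ne_zero_of_sum_ne_zero hi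
        rw [ite_ne_right_iff] at hx
        have h2 := left_ne_zero_of_mul hx.2
        rw [ite_ne_right_iff] at h2
        have h3 : u (s i, x.1 + α i) ≠ 0 := fun h => h2.2 (by rw [h, zero_div])
        obtain ⟨p', hp', hor⟩ := ih _ hx.1 h3
        refine ⟨p', hp', Or.inr ?_⟩
        rcases hor with rfl | hor
        · exact hx.1
        · exact htrans _ _ _ hor hx.1
      · exact ⟨p, hF, Or.inl rfl⟩
    intro i a ha
    rw [hq, ite_ne_right_iff] at ha
    exact hup _ fun h => ha.2 (by rw [h, zero_div])

/-! ### Leading exponents of power series -/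

section LeadingExponents

variable {n : ℕ} {K : Type*} [Field K] (ord : LocalOrder n)

/-- The leading exponent of the indicator series of a set of exponents is the greatest element of
that set, so `exists_isLeadExp` already contains well-foundedness. -/
theorem LocalOrder.wellFounded : WellFounded fun a b : Fin n →₀ ℕ => ord.lt b a := by
  classical
  refine WellFounded.wellFounded_iff_has_min.mpr fun s ⟨a, ha⟩ => ?_
  let p : MvPowerSeries (Fin n) ℚ := fun a => if a ∈ s then 1 else 0
  have hp : ∀ b, MvPowerSeries.coeff b p ≠ 0 ↔ b ∈ s := by
    intro b
    change (if b ∈ s then (1 : ℚ) else 0) ≠ 0 ↔ b ∈ s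
    simp
  obtain ⟨m, hm, hlt⟩ := ord.exists_isLeadExp p fun h => (hp a).mpr ha (by rw [h, map_zero])
  refine ⟨m, (hp m).mp hm, fun x hx hmx => ?_⟩
  by_cases h : x = m
  · exact ord.irrefl _ (h ▸ hmx)
  · exact ord.irrefl _ (ord.trans _ _ _ hmx (hlt x ((hp x).mpr hx) h))

variable {ord}

theorem LocalOrder.lt_of_add_lt_add {a b c : Fin n →₀ ℕ} (h : ord.lt (a + c) (b + c)) :
    ord.lt a b := by
  rcases ord.total a b with h1 | rfl | h1
  · exact h1
  · exact absurd h (ord.irrefl _)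
  · exact absurd (ord.trans _ _ _ h (ord.add_right _ _ c h1)) (ord.irrefl _)

theorem LocalOrder.add_left {a b : Fin n →₀ ℕ} (c : Fin n →₀ ℕ) (h : ord.lt a b) :
    ord.lt (c + a) (c + b) := by
  rw [add_comm c, add_comm c]
  exact ord.add_right _ _ _ h

theorem LocalOrder.IsLeadExp.eq_or_lt {p : MvPowerSeries (Fin n) K} {a b : Fin n →₀ ℕ}
    (h : ord.IsLeadExp p a) (hb : MvPowerSeries.coeff b p ≠ 0) : b = a ∨ ord.lt b a :=
  or_iff_not_imp_left.mpr (h.2 b hb)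

theorem LocalOrder.IsLeadExp.unique {p : MvPowerSeries (Fin n) K} {a b : Fin n →₀ ℕ}
    (ha : ord.IsLeadExp p a) (hb : ord.IsLeadExp p b) : a = b := by
  rcases ha.eq_or_lt hb.1 with h | h
  · exact h.symm
  rcases hb.eq_or_lt ha.1 with h' | h'
  · exact h'
  exact absurd (ord.trans _ _ _ h h') (ord.irrefl _)

theorem LocalOrder.IsLeadExp.ne_zero {p : MvPowerSeries (Fin n) K} {a : Fin n →₀ ℕ}
    (h : ord.IsLeadExp p a) : p ≠ 0 := by
  rintro rfl
  exact h.1 (map_zero _)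

theorem LocalOrder.leadExp_zero : ord.leadExp (0 : MvPowerSeries (Fin n) K) = ⊥ := by
  simp [LocalOrder.leadExp]

theorem LocalOrder.IsLeadExp.leadExp_eq {p : MvPowerSeries (Fin n) K} {a : Fin n →₀ ℕ}
    (h : ord.IsLeadExp p a) : ord.leadExp p = (a : WithBot (Fin n →₀ ℕ)) := by
  rw [LocalOrder.leadExp, dif_pos h.ne_zero]
  exact congrArg _ ((ord.exists_isLeadExp p h.ne_zero).choose_spec.unique h)

/-- The leading exponents of `p` and `f` are comparable if every exponent of `p` is bounded by an
exponent of `f`. -/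
theorem LocalOrder.le_leadExp_iff (p f : MvPowerSeries (Fin n) K) :
    ord.le (ord.leadExp p) (ord.leadExp f) ↔ ∀ b, MvPowerSeries.coeff b p ≠ 0 →
      ∃ a, MvPowerSeries.coeff a f ≠ 0 ∧ (b = a ∨ ord.lt b a) := by
  by_cases hp : p = 0
  · subst hp
    rw [LocalOrder.leadExp_zero]
    exact iff_of_true trivial fun b hb => absurd (map_zero _) hb
  obtain ⟨β, hβ⟩ := ord.exists_isLeadExp p hp
  rw [hβ.leadExp_eq]
  by_cases hf : f = 0
  · subst hf
    rw [LocalOrder.leadExp_zero]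
    refine iff_of_false (fun h => h) fun h => ?_
    obtain ⟨a, ha, -⟩ := h β hβ.1
    exact ha (map_zero _)
  obtain ⟨α, hα⟩ := ord.exists_isLeadExp f hf
  rw [hα.leadExp_eq]
  change β = α ∨ ord.lt β α ↔ _
  constructor
  · intro h b hb
    refine ⟨α, hα.1, ?_⟩
    rcases hβ.eq_or_lt hb with rfl | hb'
    · exact h
    rcases h with rfl | h
    · exact Or.inr hb'
    · exact Or.inr (ord.trans _ _ _ hb' h)
  · intro h
    obtain ⟨a, ha, hor⟩ := h β hβ.1
    rcases hα.eq_or_lt ha with rfl | ha'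
    · exact hor
    rcases hor with rfl | hor
    · exact Or.inr ha'
    · exact Or.inr (ord.trans _ _ _ hor ha')

theorem exists_coeff_ne_zero_of_coeff_mul_ne_zero {p q : MvPowerSeries (Fin n) K}
    {c : Fin n →₀ ℕ} (h : MvPowerSeries.coeff c (p * q) ≠ 0) :
    ∃ a b, a + b = c ∧ MvPowerSeries.coeff a p ≠ 0 ∧ MvPowerSeries.coeff b q ≠ 0 := by
  classical
  rw [MvPowerSeries.coeff_mul] at h
  obtain ⟨x, hx, hne⟩ := Finset.exists_ne_zero_of_sum_ne_zero h
  exact ⟨x.1, x.2, Finset.HasAntidiagonal.mem_antidiagonal.mp hx, left_ne_zero_of_mul hne,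
    right_ne_zero_of_mul hne⟩

theorem LocalOrder.IsLeadExp.mul {p q : MvPowerSeries (Fin n) K} {a b : Fin n →₀ ℕ}
    (hp : ord.IsLeadExp p a) (hq : ord.IsLeadExp q b) : ord.IsLeadExp (p * q) (a + b) := by
  classical
  have key : ∀ c d, MvPowerSeries.coeff c p ≠ 0 → MvPowerSeries.coeff d q ≠ 0 →
      (c = a ∧ d = b) ∨ ord.lt (c + d) (a + b) := by
    intro c d hc hd
    rcases hp.eq_or_lt hc with rfl | hc'
    · rcases hq.eq_or_lt hd with rfl | hd'
      · exact Or.inl ⟨rfl, rfl⟩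
      · exact Or.inr (LocalOrder.add_left _ hd')
    · rcases hq.eq_or_lt hd with rfl | hd'
      · exact Or.inr (ord.add_right _ _ _ hc')
      · exact Or.inr (ord.trans _ _ _ (ord.add_right _ _ _ hc') (LocalOrder.add_left _ hd'))
  refine ⟨?_, fun c hc hne => ?_⟩
  · rw [MvPowerSeries.coeff_mul, Finset.sum_eq_single (a, b)]
    · exact mul_ne_zero hp.1 hq.1
    · intro x hx hne
      by_contra h
      rcases key x.1 x.2 (left_ne_zero_of_mul h) (right_ne_zero_of_mul h) with h1 | h1
      · exact hne (Prod.ext h1.1 h1.2)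
      · rw [Finset.HasAntidiagonal.mem_antidiagonal.mp hx] at h1
        exact ord.irrefl _ h1
    · intro h
      refine absurd ?_ h
      rw [Finset.HasAntidiagonal.mem_antidiagonal]
  · obtain ⟨d, e, rfl, hd, he⟩ := exists_coeff_ne_zero_of_coeff_mul_ne_zero hc
    rcases key d e hd he with ⟨rfl, rfl⟩ | h
    · exact absurd rfl hne
    · exact h

theorem LocalOrder.isLeadExp_monomial (a : Fin n →₀ ℕ) {c : K} (hc : c ≠ 0) :
    ord.IsLeadExp (MvPowerSeries.monomial a c) a := by
  classical
  refine ⟨by rwa [MvPowerSeries.coeff_monomial_same], fun b hb hne => ?_⟩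
  rw [MvPowerSeries.coeff_monomial_ne hne] at hb
  exact absurd rfl hb

/-! ### Buchberger's criterion by dividing by syzygies -/

/-- Buchberger's criterion for formal power series: if all S-series have representations with
small terms, the leading exponents of the generators generate those of the ideal. -/
theorem exists_le_of_isLeadExp_sum {ι : Type*} [Fintype ι] [LinearOrder ι]
    (g : ι → MvPowerSeries (Fin n) K) (α : ι → Fin n →₀ ℕ) (hg : ∀ i, ord.IsLeadExp (g i) (α i))
    (hS : ∀ i j, i < j → ∃ q : ι → MvPowerSeries (Fin n) K,
      MvPowerSeries.monomial (α i ⊔ α j - α i) (MvPowerSeries.coeff (α i) (g i))⁻¹ * g i -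
        MvPowerSeries.monomial (α i ⊔ α j - α j) (MvPowerSeries.coeff (α j) (g j))⁻¹ * g j =
        ∑ k, q k * g k ∧
      ∀ k a, MvPowerSeries.coeff a (q k) ≠ 0 → ord.lt (a + α k) (α i ⊔ α j))
    (q : ι → MvPowerSeries (Fin n) K) {β : Fin n →₀ ℕ}
    (hβ : ord.IsLeadExp (∑ k, q k * g k) β) : ∃ i, α i ≤ β := by
  classical
  choose Q hQ hQlt using hS
  -- The Schreyer order: the position `(k, a)` is weighed by the leading exponent `a + α k` of `X^a
  -- * g k`, and among equal weights the smaller index is the greater position.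
  let gt : ι × (Fin n →₀ ℕ) → ι × (Fin n →₀ ℕ) → Prop := fun p p' =>
    ord.lt (p'.2 + α p'.1) (p.2 + α p.1) ∨ (p.2 + α p.1 = p'.2 + α p'.1 ∧ p.1 < p'.1)
  have wf : WellFounded gt := by
    refine Subrelation.wf ?_ (InvImage.wf (fun p : ι × (Fin n →₀ ℕ) => (p.2 + α p.1, p.1))
      (WellFounded.prod_lex ord.wellFounded (wellFounded_lt (α := ι))))
    intro p p' h
    rcases h with h | ⟨h1, h2⟩
    · exact Prod.Lex.left _ _ h
    · change Prod.Lex _ _ (p.2 + α p.1, p.1) (p'.2 + α p'.1, p'.1)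
      rw [h1]
      exact Prod.Lex.right _ h2
  have htrans : ∀ p q r, gt p q → gt q r → gt p r := by
    rintro p q r (h | ⟨h, h'⟩) (h2 | ⟨h2, h2'⟩)
    · exact Or.inl (ord.trans _ _ _ h2 h)
    · exact Or.inl (h2 ▸ h)
    · exact Or.inl (h ▸ h2)
    · exact Or.inr ⟨h.trans h2, h'.trans h2'⟩
  have hadd : ∀ s a t b c, gt (s, a) (t, b) → gt (s, a + c) (t, b + c) := by
    rintro s a t b c (h | ⟨h, h'⟩)
    · left
      have := ord.add_right _ _ c h
      simpa only [add_right_comm _ c] using this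
    · right
      refine ⟨?_, h'⟩
      simp only [add_right_comm _ c] at h ⊢
      rw [h]
  -- The syzygy of the pair `i < j`. Its leading position is `(i, α i ⊔ α j - α i)`: the monomial at
  -- `j` has the same weight but a larger index, and the terms of `Q` have smaller weight.
  let G : {x : ι × ι // x.1 < x.2} → ι → MvPowerSeries (Fin n) K := fun x t =>
    (if t = x.1.1 then MvPowerSeries.monomial (α x.1.1 ⊔ α x.1.2 - α x.1.1)
        (MvPowerSeries.coeff (α x.1.1) (g x.1.1))⁻¹ else 0) -
      (if t = x.1.2 then MvPowerSeries.monomial (α x.1.1 ⊔ α x.1.2 - α x.1.2)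
        (MvPowerSeries.coeff (α x.1.2) (g x.1.2))⁻¹ else 0) - Q x.1.1 x.1.2 x.2 t
  have hGg : ∀ x, ∑ t, G x t * g t = 0 := by
    intro x
    simp only [G, sub_mul, Finset.sum_sub_distrib, ite_mul, zero_mul, Finset.sum_ite_eq',
      Finset.mem_univ, if_true]
    rw [hQ _ _ x.2, sub_self]
  have h0 : ∀ x : {x : ι × ι // x.1 < x.2},
      MvPowerSeries.coeff (α x.1.1 ⊔ α x.1.2 - α x.1.1) (G x x.1.1) ≠ 0 := by
    intro x
    have hz : MvPowerSeries.coeff (α x.1.1 ⊔ α x.1.2 - α x.1.1) (Q x.1.1 x.1.2 x.2 x.1.1) = 0 := by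
      by_contra h
      have := hQlt _ _ _ _ _ h
      rw [tsub_add_cancel_of_le le_sup_left] at this
      exact ord.irrefl _ this
    have hG : G x x.1.1 = MvPowerSeries.monomial (α x.1.1 ⊔ α x.1.2 - α x.1.1)
        (MvPowerSeries.coeff (α x.1.1) (g x.1.1))⁻¹ - 0 - Q x.1.1 x.1.2 x.2 x.1.1 := by
      change (if _ then _ else _) - (if _ then _ else _) - _ = _
      rw [if_pos rfl, if_neg x.2.ne]
    rw [hG, map_sub, hz, sub_zero, sub_zero, MvPowerSeries.coeff_monomial_same]
    exact inv_ne_zero (hg _).1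
  have hlt : ∀ (x : {x : ι × ι // x.1 < x.2}) t b, MvPowerSeries.coeff b (G x t) ≠ 0 →
      (x.1.1, α x.1.1 ⊔ α x.1.2 - α x.1.1) = (t, b) ∨
        gt (x.1.1, α x.1.1 ⊔ α x.1.2 - α x.1.1) (t, b) := by
    intro x t b hb
    have hL1 := tsub_add_cancel_of_le (le_sup_left : α x.1.1 ≤ α x.1.1 ⊔ α x.1.2)
    have hL2 := tsub_add_cancel_of_le (le_sup_right : α x.1.2 ≤ α x.1.1 ⊔ α x.1.2)
    by_cases hq : MvPowerSeries.coeff b (Q x.1.1 x.1.2 x.2 t) = 0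
    · by_cases h1 : t = x.1.1
      · by_cases hb1 : b = α x.1.1 ⊔ α x.1.2 - α x.1.1
        · left
          rw [h1, hb1]
        · refine absurd ?_ hb
          simp only [G, map_sub, hq, if_pos h1, if_neg (h1.trans_ne x.2.ne),
            MvPowerSeries.coeff_monomial_ne hb1, sub_zero]
      · by_cases h2 : t = x.1.2
        · by_cases hb1 : b = α x.1.1 ⊔ α x.1.2 - α x.1.2
          · right; right
            refine ⟨?_, h2 ▸ x.2⟩
            simp only [h2, hb1, hL1, hL2]
          · refine absurd ?_ hb
            simp only [G, map_sub, hq, if_neg h1, if_pos h2, map_zero,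
              MvPowerSeries.coeff_monomial_ne hb1, sub_zero]
        · refine absurd ?_ hb
          simp only [G, map_sub, hq, if_neg h1, if_neg h2, map_zero, sub_zero]
    · right; left
      simp only [hL1]
      exact hQlt _ _ _ _ _ hq
  -- `r` represents the same sum as `q`, but no exponent of `r i` is a multiple of `α i ⊔ α j - α i`
  -- for `i < j`.
  obtain ⟨c, r, hc, hr, -⟩ := exists_formal_division gt wf htrans hadd G
    (fun x => x.1.1) _ h0 hlt q
  have hsum : ∑ k, q k * g k = ∑ k, r k * g k := by
    simp only [hc, add_mul, Finset.sum_add_distrib, Finset.sum_mul]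
    rw [Finset.sum_comm, Finset.sum_eq_zero, zero_add]
    intro x _
    simp only [mul_assoc]
    rw [← Finset.mul_sum, hGg, mul_zero]
  rw [hsum] at hβ
  have hne : {p : ι × (Fin n →₀ ℕ) | MvPowerSeries.coeff p.2 (r p.1) ≠ 0}.Nonempty := by
    have h := hβ.1
    rw [map_sum] at h
    obtain ⟨k, -, hk⟩ := Finset.exists_ne_zero_of_sum_ne_zero h
    obtain ⟨a, b, -, ha, -⟩ := exists_coeff_ne_zero_of_coeff_mul_ne_zero hk
    exact ⟨(k, a), ha⟩
  -- Minimal for `gt` means greatest: `(i, a)` is the leading position of the vector `r`.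
  obtain ⟨⟨i, a⟩, hia, hmin⟩ := WellFounded.wellFounded_iff_has_min.mp wf _ hne
  have hmax : ∀ t b, MvPowerSeries.coeff b (r t) ≠ 0 → (t = i ∧ b = a) ∨ gt (i, a) (t, b) := by
    intro t b hb
    have hnot := hmin (t, b) hb
    rcases ord.total (b + α t) (a + α i) with h | h | h
    · exact Or.inr (Or.inl h)
    · rcases lt_trichotomy t i with h' | rfl | h'
      · exact absurd (Or.inr ⟨h, h'⟩) hnot
      · exact Or.inl ⟨rfl, add_right_cancel h⟩
      · exact Or.inr (Or.inr ⟨h.symm, h'⟩)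
    · exact absurd (Or.inl h) hnot
  have hri : ord.IsLeadExp (r i) a := by
    refine ⟨hia, fun b hb hne => ?_⟩
    rcases hmax i b hb with ⟨-, h⟩ | h | ⟨-, h⟩
    · exact absurd h hne
    · exact LocalOrder.lt_of_add_lt_add h
    · exact absurd h (lt_irrefl _)
  have hlt' : ∀ t, t ≠ i → ∀ d, MvPowerSeries.coeff d (r t * g t) ≠ 0 → ord.lt d (a + α i) := by
    intro t hti d hd
    obtain ⟨b, e, rfl, hb, he⟩ := exists_coeff_ne_zero_of_coeff_mul_ne_zero hd
    have h1 : ord.lt (b + α t) (a + α i) := by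
      rcases hmax t b hb with ⟨h, -⟩ | h | ⟨h, h'⟩
      · exact absurd h hti
      · exact h
      -- If `i < t` and the weights agree, `a + α i` is a common multiple of `α i` and `α t`, so `a`
      -- would be divisible by the leading exponent of the syzygy of `(i, t)`.
      · refine absurd ?_ (hr i a hia ⟨(i, t), h'⟩ rfl)
        simp only at h ⊢
        rw [tsub_le_iff_right]
        exact sup_le le_add_self (h ▸ le_add_self)
    rcases (hg t).eq_or_lt he with rfl | h2
    · exact h1
    · exact ord.trans _ _ _ (LocalOrder.add_left _ h2) h1
  have hlead : ord.IsLeadExp (∑ k, r k * g k) (a + α i) := by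
    have hm := hri.mul (hg i)
    constructor
    · rw [map_sum, Finset.sum_eq_single i]
      · exact hm.1
      · intro t _ hti
        by_contra h
        exact ord.irrefl _ (hlt' t hti _ h)
      · intro h
        exact absurd (Finset.mem_univ i) h
    · intro d hd hne
      rw [map_sum] at hd
      obtain ⟨t, -, ht⟩ := Finset.exists_ne_zero_of_sum_ne_zero hd
      by_cases hti : t = i
      · subst hti
        exact hm.2 d ht hne
      · exact hlt' t hti d ht
  exact ⟨i, hβ.unique hlead ▸ le_add_self⟩

end LeadingExponents

/-! ### Passing from the ring to jets -/

/-- The jet of `T` is a surjective ring homomorphism `J`, and the terms behave as monomials. -/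
structure JetData.IsJetHom {n : ℕ} {K R : Type*} [Field K] [CommRing R] (T : JetData n K R)
    (J : R →+* MvPowerSeries (Fin n) K) : Prop where
  jet_eq : T.jet = J
  surjective : Function.Surjective J
  jet_term : ∀ α c, J (T.term α c) = MvPowerSeries.monomial α c
  term_add : ∀ α β c d, T.term (α + β) (c * d) = T.term α c * T.term β d

namespace JetData.IsJetHom

variable {n : ℕ} {K R : Type*} [Field K] [CommRing R] {T : JetData n K R}
  {J : R →+* MvPowerSeries (Fin n) K} {ord : LocalOrder n} {m : ℕ} {g : Fin m → R}

theorem flat_iff (h : T.IsJetHom J) (f : R) : T.Flat f ↔ J f = 0 := by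
  rw [JetData.Flat, h.jet_eq]

theorem LT_eq_term (h : T.IsJetHom J) {f : R} {α : Fin n →₀ ℕ} (hf : ord.IsLeadExp (J f) α) :
    T.LT ord f = T.term α (MvPowerSeries.coeff α (J f)) := by
  unfold JetData.LT
  rw [h.jet_eq, hf.leadExp_eq]

theorem LT_eq_zero (h : T.IsJetHom J) {f : R} (hf : J f = 0) : T.LT ord f = 0 := by
  unfold JetData.LT
  rw [h.jet_eq, hf, LocalOrder.leadExp_zero]

theorem SGerm_eq (h : T.IsJetHom J) {f g : R} {α β : Fin n →₀ ℕ} (hf : ord.IsLeadExp (J f) α)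
    (hg : ord.IsLeadExp (J g) β) : T.SGerm ord f g =
      T.term (α ⊔ β - α) (MvPowerSeries.coeff α (J f))⁻¹ * f -
        T.term (α ⊔ β - β) (MvPowerSeries.coeff β (J g))⁻¹ * g := by
  unfold JetData.SGerm
  rw [h.jet_eq, hf.leadExp_eq, hg.leadExp_eq]

theorem SGerm_eq_zero (h : T.IsJetHom J) {f g : R} (hfg : J f = 0 ∨ J g = 0) :
    T.SGerm ord f g = 0 := by
  unfold JetData.SGerm
  rw [h.jet_eq]
  rcases hfg with hf | hg
  · rw [hf, LocalOrder.leadExp_zero]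
  · rw [hg, LocalOrder.leadExp_zero]
    rcases ord.leadExp (J f) with _ | _ <;> rfl

theorem SGerm_mem (h : T.IsJetHom J) (i j : Fin m) :
    T.SGerm ord (g i) (g j) ∈ Ideal.span (Set.range g) := by
  by_cases hi : J (g i) = 0
  · rw [h.SGerm_eq_zero (Or.inl hi)]
    exact zero_mem _
  by_cases hj : J (g j) = 0
  · rw [h.SGerm_eq_zero (Or.inr hj)]
    exact zero_mem _
  obtain ⟨α, hα⟩ := ord.exists_isLeadExp _ hi
  obtain ⟨β, hβ⟩ := ord.exists_isLeadExp _ hj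
  rw [h.SGerm_eq hα hβ]
  exact sub_mem (Ideal.mul_mem_left _ _ (Ideal.subset_span ⟨i, rfl⟩))
    (Ideal.mul_mem_left _ _ (Ideal.subset_span ⟨j, rfl⟩))

/-- Divisibility in `R` descends to jets, where it compares exponents; the quotient of two terms is
again a term by `term_add`, so no flat error appears on the way back. A flat `f` has leading term
`0` and no leading exponent, and both sides fail. -/
theorem LT_dvd_term_iff (h : T.IsJetHom J) (f : R) (β : Fin n →₀ ℕ) {c : K} (hc : c ≠ 0) :
    T.LT ord f ∣ T.term β c ↔ ∃ α, ord.IsLeadExp (J f) α ∧ α ≤ β := by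
  constructor
  · rintro ⟨y, hy⟩
    have hJ := congrArg J hy
    rw [h.jet_term, map_mul] at hJ
    have hβ : MvPowerSeries.coeff β (J (T.LT ord f) * J y) ≠ 0 := by
      rwa [← hJ, MvPowerSeries.coeff_monomial_same]
    by_cases hf : J f = 0
    · rw [h.LT_eq_zero hf, map_zero, zero_mul, map_zero] at hβ
      exact absurd rfl hβ
    obtain ⟨α, hα⟩ := ord.exists_isLeadExp _ hf
    rw [h.LT_eq_term hα, h.jet_term] at hβ
    obtain ⟨a, b, hab, ha, -⟩ := exists_coeff_ne_zero_of_coeff_mul_ne_zero hβ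
    refine ⟨α, hα, ?_⟩
    rcases eq_or_ne a α with rfl | hne
    · exact hab ▸ le_self_add
    · rw [MvPowerSeries.coeff_monomial_ne hne] at ha
      exact absurd rfl ha
  · rintro ⟨α, hα, hle⟩
    refine ⟨T.term (β - α) (c / MvPowerSeries.coeff α (J f)), ?_⟩
    rw [h.LT_eq_term hα, ← h.term_add, add_tsub_cancel_of_le hle, mul_div_cancel₀ _ hα.1]

theorem isRemainder_iff (h : T.IsJetHom J) (f r : R) : T.IsRemainder ord g f r ↔
    (∃ q : Fin m → R, r = f - ∑ i, q i * g i ∧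
      ∀ i b, MvPowerSeries.coeff b (J (q i) * J (g i)) ≠ 0 →
        ∃ a, MvPowerSeries.coeff a (J f) ≠ 0 ∧ (b = a ∨ ord.lt b a)) ∧
    ∀ b, MvPowerSeries.coeff b (J r) ≠ 0 → ∀ i α, ord.IsLeadExp (J (g i)) α → ¬ α ≤ b := by
  unfold JetData.IsRemainder
  simp only [h.jet_eq, LocalOrder.le_leadExp_iff, map_mul]
  refine and_congr_right fun _ => ?_
  constructor
  · intro hr b hb i α hα hle
    refine hr i _ ⟨b, ?_, rfl⟩ ?_
    · rwa [h.jet_eq]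
    · rw [h.jet_eq]
      exact (h.LT_dvd_term_iff _ _ hb).mpr ⟨α, hα, hle⟩
  · rintro hr i _ ⟨b, hb, rfl⟩ hdvd
    rw [h.jet_eq] at hb hdvd
    obtain ⟨α, hα, hle⟩ := (h.LT_dvd_term_iff _ _ hb).mp hdvd
    exact hr b hb i α hα hle

theorem isStandardBasis_iff (h : T.IsJetHom J) : T.IsStandardBasis ord g ↔
    ∀ f ∈ Ideal.span (Set.range g), ∀ β, ord.IsLeadExp (J f) β →
      ∃ i α, ord.IsLeadExp (J (g i)) α ∧ α ≤ β := by
  unfold JetData.IsStandardBasis JetData.LTIdeal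
  constructor
  · intro hg f hf β hβ
    have hmem : T.LT ord f ∈ Ideal.span (Set.range fun i => T.LT ord (g i)) := by
      rw [← hg]
      exact Ideal.subset_span ⟨f, hf, rfl⟩
    obtain ⟨c, hc⟩ := Ideal.mem_span_range_iff_exists_fun.mp hmem
    have hJ := congrArg (fun x => MvPowerSeries.coeff β (J x)) hc
    simp only [h.LT_eq_term hβ, h.jet_term, MvPowerSeries.coeff_monomial_same, map_sum,
      map_mul] at hJ
    obtain ⟨i, -, hi⟩ := Finset.exists_ne_zero_of_sum_ne_zero (hJ.trans_ne hβ.1)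
    refine ⟨i, ?_⟩
    by_cases hgi : J (g i) = 0
    · rw [h.LT_eq_zero hgi, map_zero, mul_zero, map_zero] at hi
      exact absurd rfl hi
    obtain ⟨α, hα⟩ := ord.exists_isLeadExp _ hgi
    refine ⟨α, hα, ?_⟩
    rw [h.LT_eq_term hα, h.jet_term] at hi
    obtain ⟨a, b, hab, -, hb⟩ := exists_coeff_ne_zero_of_coeff_mul_ne_zero hi
    rcases eq_or_ne b α with rfl | hne
    · exact hab ▸ le_add_self
    · rw [MvPowerSeries.coeff_monomial_ne hne] at hb
      exact absurd rfl hb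
  · intro hg
    refine le_antisymm (Ideal.span_le.mpr ?_) (Ideal.span_mono ?_)
    · rintro _ ⟨f, hf, rfl⟩
      by_cases hf0 : J f = 0
      · rw [h.LT_eq_zero hf0]
        exact zero_mem _
      obtain ⟨β, hβ⟩ := ord.exists_isLeadExp _ hf0
      obtain ⟨i, α, hα, hle⟩ := hg f hf β hβ
      rw [h.LT_eq_term hβ]
      exact Ideal.mem_of_dvd _ ((h.LT_dvd_term_iff (g i) β hβ.1).mpr ⟨α, hα, hle⟩)
        (Ideal.subset_span ⟨i, rfl⟩)
    · rintro _ ⟨i, rfl⟩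
      exact ⟨g i, Ideal.subset_span ⟨i, rfl⟩, rfl⟩

theorem mem_span_of_isRemainder {f r : R} (hf : f ∈ Ideal.span (Set.range g))
    (hr : T.IsRemainder ord g f r) : r ∈ Ideal.span (Set.range g) := by
  obtain ⟨⟨q, rfl, -⟩, -⟩ := hr
  exact sub_mem hf (sum_mem fun i _ => Ideal.mul_mem_left _ _ (Ideal.subset_span ⟨i, rfl⟩))

-- Flat generators have no leading exponent and must be discarded before the formal results apply;
-- they do not affect the jet of a combination.
open Classical in
theorem sum_jet_eq (c : Fin m → R) : J (∑ i, c i * g i) =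
    ∑ i : {i // J (g i) ≠ 0}, J (c i) * J (g i) := by
  have h1 : ∀ i ∈ Finset.univ, J (c i * g i) ≠ 0 → J (g i) ≠ 0 := by
    intro i _ hi h0
    exact hi (by rw [map_mul, h0, mul_zero])
  rw [map_sum, ← Finset.sum_filter_of_ne h1,
    Finset.sum_subtype (F := inferInstance) _ (p := fun i => J (g i) ≠ 0) (by simp)]
  simp only [map_mul]

/-! ### Existence of remainders and the criteria -/

theorem exists_isRemainder (h : T.IsJetHom J) (ord : LocalOrder n) (g : Fin m → R) (f : R) :
    ∃ r, T.IsRemainder ord g f r := by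
  classical
  choose α hα using fun i : {i // J (g i) ≠ 0} => ord.exists_isLeadExp _ i.2
  -- Rank one: `σ = Unit`, so positions are just exponents.
  obtain ⟨q, r, hq, hr, hle⟩ := exists_formal_division (σ := Unit)
    (fun p p' => ord.lt p'.2 p.2) (InvImage.wf Prod.snd ord.wellFounded)
    (fun p q r h1 h2 => ord.trans _ _ _ h2 h1) (fun _ _ _ _ c hlt => ord.add_right _ _ c hlt)
    (fun (i : {i // J (g i) ≠ 0}) _ => J (g i)) (fun _ => ()) α (fun i => (hα i).1)
    (fun i t b hb => by
      rcases (hα i).eq_or_lt hb with rfl | hlt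
      · exact Or.inl rfl
      · exact Or.inr hlt) (fun _ => J f)
  choose q' hq' using fun i => h.surjective (q i)
  let Q : Fin m → R := fun i => if hi : J (g i) ≠ 0 then q' ⟨i, hi⟩ else 0
  have hQ : ∀ i : {i // J (g i) ≠ 0}, J (Q i) = q i := by
    intro i
    simp only [Q]
    rw [dif_pos i.2, hq']
  have hJr : J (f - ∑ i, Q i * g i) = r () := by
    rw [map_sub, sum_jet_eq, hq ()]
    simp only [hQ, add_sub_cancel_left]
  refine ⟨f - ∑ i, Q i * g i, (h.isRemainder_iff _ _).mpr ⟨⟨Q, rfl, ?_⟩, ?_⟩⟩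
  · intro i b hb
    have hi : J (g i) ≠ 0 := by
      intro h0
      rw [h0, mul_zero, map_zero] at hb
      exact hb rfl
    obtain ⟨c, d, rfl, hc, hd⟩ := exists_coeff_ne_zero_of_coeff_mul_ne_zero hb
    rw [hQ ⟨i, hi⟩] at hc
    obtain ⟨⟨_, p⟩, hp, hor⟩ := hle ⟨i, hi⟩ c hc
    refine ⟨p, hp, ?_⟩
    have h1 : c + α ⟨i, hi⟩ = p ∨ ord.lt (c + α ⟨i, hi⟩) p :=
      hor.imp (fun e => (Prod.mk.inj e).2.symm) id
    rcases (hα ⟨i, hi⟩).eq_or_lt hd with rfl | hlt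
    · exact h1
    · right
      have h2 := LocalOrder.add_left c hlt
      rcases h1 with h1 | h1
      · exact h1 ▸ h2
      · exact ord.trans _ _ _ h2 h1
  · intro b hb i β hβ hle
    rw [hJr] at hb
    refine hr () b hb ⟨i, hβ.ne_zero⟩ rfl ?_
    rwa [(hα ⟨i, hβ.ne_zero⟩).unique hβ]

theorem flat_of_isRemainder_of_flat (h : T.IsJetHom J) {f r : R} (hf : J f = 0)
    (hr : T.IsRemainder ord g f r) : J r = 0 := by
  obtain ⟨⟨q, rfl, hq⟩, -⟩ := (h.isRemainder_iff _ _).mp hr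
  rw [map_sub, hf, map_sum, zero_sub, neg_eq_zero]
  refine Finset.sum_eq_zero fun i _ => MvPowerSeries.ext fun b => ?_
  by_contra hb
  rw [map_mul] at hb
  obtain ⟨a, ha, -⟩ := hq i b (by simpa using hb)
  rw [hf, map_zero] at ha
  exact ha rfl

theorem flat_of_isRemainder_of_mem (h : T.IsJetHom J) (hg : T.IsStandardBasis ord g) {f r : R}
    (hf : f ∈ Ideal.span (Set.range g)) (hr : T.IsRemainder ord g f r) : T.Flat r := by
  rw [h.flat_iff]
  by_contra h0
  obtain ⟨β, hβ⟩ := ord.exists_isLeadExp _ h0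
  obtain ⟨i, α, hα, hle⟩ := h.isStandardBasis_iff.mp hg r (mem_span_of_isRemainder hf hr) β hβ
  exact ((h.isRemainder_iff _ _).mp hr).2 β hβ.1 i α hα hle

/-- The difference lies in the ideal, so a leading monomial of it would be divisible by that of a
generator; but that monomial occurs in `r` or in `r'`. -/
theorem flat_sub_of_isRemainder (h : T.IsJetHom J) (hg : T.IsStandardBasis ord g) {f r r' : R}
    (hr : T.IsRemainder ord g f r) (hr' : T.IsRemainder ord g f r') : T.Flat (r - r') := by
  rw [h.flat_iff]
  by_contra h0
  obtain ⟨β, hβ⟩ := ord.exists_isLeadExp _ h0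
  have hmem : r - r' ∈ Ideal.span (Set.range g) := by
    obtain ⟨⟨q, rfl, -⟩, -⟩ := hr
    obtain ⟨⟨q', rfl, -⟩, -⟩ := hr'
    rw [sub_sub_sub_cancel_left]
    exact sub_mem (sum_mem fun i _ => Ideal.mul_mem_left _ _ (Ideal.subset_span ⟨i, rfl⟩))
      (sum_mem fun i _ => Ideal.mul_mem_left _ _ (Ideal.subset_span ⟨i, rfl⟩))
  obtain ⟨i, α, hα, hle⟩ := h.isStandardBasis_iff.mp hg _ hmem β hβ
  have hb := hβ.1
  rw [map_sub, map_sub] at hb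
  by_cases h1 : MvPowerSeries.coeff β (J r) = 0
  · refine ((h.isRemainder_iff _ _).mp hr').2 β (fun h2 => hb ?_) i α hα hle
    rw [h1, h2, sub_zero]
  · exact ((h.isRemainder_iff _ _).mp hr).2 β h1 i α hα hle

theorem isLeadExp_jet_term_mul (h : T.IsJetHom J) {f : R} {α L : Fin n →₀ ℕ}
    (hf : ord.IsLeadExp (J f) α) (hL : α ≤ L) :
    ord.IsLeadExp (J (T.term (L - α) (MvPowerSeries.coeff α (J f))⁻¹ * f)) L ∧
      MvPowerSeries.coeff L (J (T.term (L - α) (MvPowerSeries.coeff α (J f))⁻¹ * f)) = 1 := by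
  rw [map_mul, h.jet_term]
  have hadd := tsub_add_cancel_of_le hL
  constructor
  · have := (LocalOrder.isLeadExp_monomial (ord := ord) (L - α) (inv_ne_zero hf.1)).mul hf
    rwa [hadd] at this
  · conv_lhs => rw [← hadd, add_tsub_cancel_right, MvPowerSeries.coeff_add_monomial_mul,
      inv_mul_cancel₀ hf.1]

/-- Both multiples have leading monomial `X^(α ⊔ β)` with coefficient `1`, so these cancel. -/
theorem lt_of_coeff_jet_SGerm_ne_zero (h : T.IsJetHom J) {f g : R} {α β b : Fin n →₀ ℕ}
    (hf : ord.IsLeadExp (J f) α) (hg : ord.IsLeadExp (J g) β)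
    (hb : MvPowerSeries.coeff b (J (T.SGerm ord f g)) ≠ 0) : ord.lt b (α ⊔ β) := by
  obtain ⟨h1, h1'⟩ := h.isLeadExp_jet_term_mul hf (le_sup_left : α ≤ α ⊔ β)
  obtain ⟨h2, h2'⟩ := h.isLeadExp_jet_term_mul hg (le_sup_right : β ≤ α ⊔ β)
  rw [h.SGerm_eq hf hg, map_sub, map_sub] at hb
  have hne : b ≠ α ⊔ β := by
    rintro rfl
    rw [h1', h2', sub_self] at hb
    exact hb rfl
  by_cases h0 : MvPowerSeries.coeff b
      (J (T.term (α ⊔ β - α) (MvPowerSeries.coeff α (J f))⁻¹ * f)) = 0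
  · rw [h0, zero_sub, neg_ne_zero] at hb
    exact h2.2 b hb hne
  · exact h1.2 b h0 hne

theorem isStandardBasis_of_SGerm (h : T.IsJetHom J)
    (hS : ∀ i j, ∃ r, T.IsRemainder ord g (T.SGerm ord (g i) (g j)) r ∧ T.Flat r) :
    T.IsStandardBasis ord g := by
  classical
  rw [h.isStandardBasis_iff]
  intro f hf β hβ
  choose α hα using fun i : {i // J (g i) ≠ 0} => ord.exists_isLeadExp _ i.2
  obtain ⟨c, rfl⟩ := Ideal.mem_span_range_iff_exists_fun.mp hf
  rw [sum_jet_eq] at hβ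
  obtain ⟨i, hi⟩ := exists_le_of_isLeadExp_sum (fun i : {i // J (g i) ≠ 0} => J (g i)) α hα
    (fun i j _ => by
      obtain ⟨r, hr, hflat⟩ := hS i j
      obtain ⟨⟨q, hrq, hq⟩, -⟩ := (h.isRemainder_iff _ _).mp hr
      refine ⟨fun k => J (q k), ?_, ?_⟩
      · rw [h.flat_iff, hrq, map_sub, sub_eq_zero, sum_jet_eq, h.SGerm_eq (hα i) (hα j),
          map_sub, map_mul, map_mul, h.jet_term, h.jet_term] at hflat
        exact hflat
      · intro k a ha
        have hqk : J (q k) ≠ 0 := fun h0 => ha (by simp only [h0, map_zero])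
        -- The bound on the product `q k * g k` passes to each term of `q k`, because the product of
        -- the leading monomials does not cancel.
        obtain ⟨d, hd⟩ := ord.exists_isLeadExp _ hqk
        obtain ⟨e, he, hor⟩ := hq k _ (hd.mul (hα k)).1
        have hlt := h.lt_of_coeff_jet_SGerm_ne_zero (hα i) (hα j) he
        have h1 : ord.lt (d + α k) (α i ⊔ α j) := by
          rcases hor with hor | hor
          · exact hor ▸ hlt
          · exact ord.trans _ _ _ hor hlt
        rcases hd.eq_or_lt ha with rfl | h2
        · exact h1
        · exact ord.trans _ _ _ (ord.add_right _ _ _ h2) h1)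
    (fun i => J (c i)) hβ
  exact ⟨i, α i, hα i, hi⟩

theorem flat_of_isRemainder_SGerm (h : T.IsJetHom J)
    (huniq : ∀ f r r', T.IsRemainder ord g f r → T.IsRemainder ord g f r' → T.Flat (r - r'))
    {i j : Fin m} {r : R} (hr : T.IsRemainder ord g (T.SGerm ord (g i) (g j)) r) :
    T.Flat r := by
  classical
  rw [h.flat_iff]
  by_cases hi : J (g i) = 0
  · rw [h.SGerm_eq_zero (Or.inl hi)] at hr
    exact h.flat_of_isRemainder_of_flat (map_zero J) hr
  by_cases hj : J (g j) = 0
  · rw [h.SGerm_eq_zero (Or.inr hj)] at hr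
    exact h.flat_of_isRemainder_of_flat (map_zero J) hr
  obtain ⟨α, hα⟩ := ord.exists_isLeadExp _ hi
  obtain ⟨β, hβ⟩ := ord.exists_isLeadExp _ hj
  obtain ⟨h1, -⟩ := h.isLeadExp_jet_term_mul hα (le_sup_left : α ≤ α ⊔ β)
  obtain ⟨h2, -⟩ := h.isLeadExp_jet_term_mul hβ (le_sup_right : β ≤ α ⊔ β)
  obtain ⟨⟨q, hrq, hq⟩, hr2⟩ := (h.isRemainder_iff _ _).mp hr
  have hlt : ∀ b, MvPowerSeries.coeff b (J (T.SGerm ord (g i) (g j))) ≠ 0 →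
      ord.lt b (α ⊔ β) := fun b hb => h.lt_of_coeff_jet_SGerm_ne_zero hα hβ hb
  rw [h.SGerm_eq hα hβ] at hrq
  set s := T.term (α ⊔ β - α) (MvPowerSeries.coeff α (J (g i)))⁻¹
  set t := T.term (α ⊔ β - β) (MvPowerSeries.coeff β (J (g j)))⁻¹
  have hsingle : ∀ (k : Fin m) (x : R), ∑ l, Pi.single (M := fun _ => R) k x l * g l = x * g k := by
    intro k x
    rw [Finset.sum_eq_single k]
    · rw [Pi.single_eq_same]
    · intro l _ hl
      rw [Pi.single_eq_of_ne hl, zero_mul]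
    · intro hk
      exact absurd (Finset.mem_univ k) hk
  have hcoeff : ∀ (k : Fin m) (x : R) l b,
      MvPowerSeries.coeff b (J (Pi.single (M := fun _ => R) k x l) * J (g l)) ≠ 0 →
      MvPowerSeries.coeff b (J (x * g k)) ≠ 0 := by
    intro k x l b hb
    rcases eq_or_ne l k with rfl | hl
    · rwa [Pi.single_eq_same, ← map_mul] at hb
    · rw [Pi.single_eq_of_ne hl, map_zero, zero_mul, map_zero] at hb
      exact absurd rfl hb
  -- Writing `S` for the S-germ, `s * g i = S + t * g j`. The element `s * g i` is divided exactly
  -- by `g i`; alternatively, subtracting `t * g j` and then dividing `S` leaves `r`. Both are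
  -- legitimate, as all the products involved are bounded by the common leading monomial.
  have hrem0 : T.IsRemainder ord g (s * g i) 0 := by
    refine (h.isRemainder_iff _ _).mpr ⟨⟨Pi.single i s, ?_, ?_⟩, ?_⟩
    · rw [hsingle, sub_self]
    · intro l b hb
      exact ⟨_, h1.1, h1.eq_or_lt (hcoeff _ _ _ _ hb)⟩
    · intro b hb
      rw [map_zero, map_zero] at hb
      exact absurd rfl hb
  have hremr : T.IsRemainder ord g (s * g i) r := by
    refine (h.isRemainder_iff _ _).mpr ⟨⟨q + Pi.single j t, ?_, ?_⟩, hr2⟩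
    · simp only [Pi.add_apply, add_mul, Finset.sum_add_distrib, hsingle]
      rw [hrq]
      ring
    · intro l b hb
      refine ⟨_, h1.1, ?_⟩
      rw [Pi.add_apply, map_add, add_mul, map_add] at hb
      by_cases hb1 : MvPowerSeries.coeff b (J (q l) * J (g l)) = 0
      · rw [hb1, zero_add] at hb
        exact h2.eq_or_lt (hcoeff _ _ _ _ hb)
      · obtain ⟨a, ha, hor⟩ := hq l b hb1
        right
        rcases hor with rfl | hor
        · exact hlt _ ha
        · exact ord.trans _ _ _ hor (hlt _ ha)
  have := huniq _ _ _ hremr hrem0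
  rwa [sub_zero, h.flat_iff] at this

theorem division_and_criteria (h : T.IsJetHom J) (ord : LocalOrder n) (g : Fin m → R) :
    (∀ f, ∃ r, T.IsRemainder ord g f r) ∧
    (T.IsStandardBasis ord g ↔ ∀ f r r', T.IsRemainder ord g f r → T.IsRemainder ord g f r' →
      T.Flat (r - r')) ∧
    (T.IsStandardBasis ord g ↔
      ∀ i j r, T.IsRemainder ord g (T.SGerm ord (g i) (g j)) r → T.Flat r) ∧
    (T.IsStandardBasis ord g ↔
      ∀ i j, ∃ r, T.IsRemainder ord g (T.SGerm ord (g i) (g j)) r ∧ T.Flat r) ∧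
    (T.IsStandardBasis ord g ↔
      ∀ f ∈ Ideal.span (Set.range g), ∀ r, T.IsRemainder ord g f r → T.Flat r) ∧
    (T.IsStandardBasis ord g ↔
      ∀ f ∈ Ideal.span (Set.range g), ∃ r, T.IsRemainder ord g f r ∧ T.Flat r) := by
  have hex := h.exists_isRemainder ord g
  have hall : (∀ i j r, T.IsRemainder ord g (T.SGerm ord (g i) (g j)) r → T.Flat r) →
      T.IsStandardBasis ord g := fun H => h.isStandardBasis_of_SGerm fun i j =>
    (hex _).imp fun r hr => ⟨hr, H i j r hr⟩
  refine ⟨hex, ⟨?_, ?_⟩, ⟨?_, hall⟩, ⟨?_, h.isStandardBasis_of_SGerm⟩, ⟨?_, ?_⟩, ?_, ?_⟩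
  · exact fun hg f r r' hr hr' => h.flat_sub_of_isRemainder hg hr hr'
  · exact fun H => hall fun i j r hr => h.flat_of_isRemainder_SGerm H hr
  · exact fun hg i j r hr => h.flat_of_isRemainder_of_mem hg (h.SGerm_mem i j) hr
  · exact fun hg i j => (hex _).imp fun r hr =>
      ⟨hr, h.flat_of_isRemainder_of_mem hg (h.SGerm_mem i j) hr⟩
  · exact fun hg f hf r hr => h.flat_of_isRemainder_of_mem hg hf hr
  · exact fun H => hall fun i j r hr => H _ (h.SGerm_mem i j) r hr
  · exact fun hg f hf => (hex f).imp fun r hr => ⟨hr, h.flat_of_isRemainder_of_mem hg hf hr⟩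
  · exact fun H => h.isStandardBasis_of_SGerm fun i j => H _ (h.SGerm_mem i j)

end JetData.IsJetHom

theorem isJetHom_formalJet (n : ℕ) (K : Type*) [Field K] :
    (formalJet n K).IsJetHom (RingHom.id _) where
  jet_eq := rfl
  surjective := Function.surjective_id
  jet_term _ _ := rfl
  term_add _ _ _ _ := (MvPowerSeries.monomial_mul_monomial ..).symm

/-! ### Multiplicativity of the Taylor series -/

section TaylorSeries

variable {n : ℕ}

/-- `f` is smooth near the origin. -/
def SmoothNearZero (f : (Fin n → ℝ) → ℝ) : Prop := ∀ᶠ y in 𝓝 0, ContDiffAt ℝ ∞ f y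

variable {f g : (Fin n → ℝ) → ℝ}

theorem _root_.ContDiff.smoothNearZero (hf : ContDiff ℝ ∞ f) : SmoothNearZero f :=
  Eventually.of_forall fun _ => hf.contDiffAt

namespace SmoothNearZero

theorem add (hf : SmoothNearZero f) (hg : SmoothNearZero g) : SmoothNearZero (f + g) := by
  filter_upwards [hf, hg] with y h1 h2 using h1.add h2

theorem mul (hf : SmoothNearZero f) (hg : SmoothNearZero g) : SmoothNearZero (f * g) := by
  filter_upwards [hf, hg] with y h1 h2 using h1.mul h2

theorem partialDeriv (hf : SmoothNearZero f) (i : Fin n) :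
    SmoothNearZero (partialDeriv i f) := by
  filter_upwards [hf] with y hy
  exact (hy.fderiv_right (m := ∞) le_rfl).clm_apply contDiffAt_const

theorem iterate_partialDeriv (hf : SmoothNearZero f) (i : Fin n) (k : ℕ) :
    SmoothNearZero ((GermDivision.partialDeriv i)^[k] f) := by
  induction k generalizing f with
  | zero => exact hf
  | succ k ih => exact ih (hf.partialDeriv i)

theorem foldr_partialDeriv (hf : SmoothNearZero f) (α : Fin n →₀ ℕ) (l : List (Fin n)) :
    SmoothNearZero (l.foldr (fun i h => (GermDivision.partialDeriv i)^[α i] h) f) := by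
  induction l with
  | nil => exact hf
  | cons j l ih => exact ih.iterate_partialDeriv j _

end SmoothNearZero

theorem partialDeriv_congr (i : Fin n) (h : f =ᶠ[𝓝 0] g) :
    partialDeriv i f =ᶠ[𝓝 0] partialDeriv i g := by
  filter_upwards [h.fderiv (𝕜 := ℝ)] with y hy
  simp only [partialDeriv, hy]

theorem iterate_partialDeriv_congr (i : Fin n) (k : ℕ) (h : f =ᶠ[𝓝 0] g) :
    (partialDeriv i)^[k] f =ᶠ[𝓝 0] (partialDeriv i)^[k] g := by
  induction k generalizing f g with
  | zero => exact h
  | succ k ih => exact ih (partialDeriv_congr i h)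

theorem partialDeriv_add (i : Fin n) (hf : SmoothNearZero f) (hg : SmoothNearZero g) :
    partialDeriv i (f + g) =ᶠ[𝓝 0] partialDeriv i f + partialDeriv i g := by
  filter_upwards [hf, hg] with y h1 h2
  simp only [partialDeriv, Pi.add_apply]
  rw [fderiv_add (h1.differentiableAt (by simp)) (h2.differentiableAt (by simp))]
  rfl

theorem partialDeriv_mul (i : Fin n) (hf : SmoothNearZero f) (hg : SmoothNearZero g) :
    partialDeriv i (f * g) =ᶠ[𝓝 0] partialDeriv i f * g + f * partialDeriv i g := by
  filter_upwards [hf, hg] with y h1 h2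
  simp only [partialDeriv, Pi.add_apply, Pi.mul_apply]
  rw [fderiv_mul (h1.differentiableAt (by simp)) (h2.differentiableAt (by simp))]
  simp only [add_apply, smul_apply, smul_eq_mul]
  ring

theorem partialDeriv_comm (i j : Fin n) (hf : SmoothNearZero f) :
    partialDeriv i (partialDeriv j f) =ᶠ[𝓝 0] partialDeriv j (partialDeriv i f) := by
  filter_upwards [hf] with y hy
  have hd : DifferentiableAt ℝ (fderiv ℝ f) y :=
    (hy.fderiv_right (m := ∞) le_rfl).differentiableAt (by simp)
  have key : ∀ a b : Fin n, partialDeriv a (partialDeriv b f) y =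
      fderiv ℝ (fderiv ℝ f) y (Pi.single a 1) (Pi.single b 1) := by
    intro a b
    unfold partialDeriv
    rw [fderiv_clm_apply hd (differentiableAt_const _)]
    simp
  rw [key, key]
  have h2 : minSmoothness ℝ 2 ≤ ∞ := by
    rw [minSmoothness_of_isRCLikeNormedField]
    exact WithTop.coe_le_coe.mpr le_top
  exact (hy.isSymmSndFDerivAt h2).eq _ _

theorem partialDeriv_iterate_comm (i j : Fin n) (k : ℕ) (hf : SmoothNearZero f) :
    partialDeriv i ((partialDeriv j)^[k] f) =ᶠ[𝓝 0] (partialDeriv j)^[k] (partialDeriv i f) := by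
  induction k generalizing f with
  | zero => rfl
  | succ k ih =>
    exact (ih (hf.partialDeriv j)).trans
      (iterate_partialDeriv_congr j k (partialDeriv_comm i j hf))

theorem partialDeriv_foldr_comm (i : Fin n) (α : Fin n →₀ ℕ) (l : List (Fin n))
    (hf : SmoothNearZero f) :
    partialDeriv i (l.foldr (fun i h => (partialDeriv i)^[α i] h) f) =ᶠ[𝓝 0]
      l.foldr (fun i h => (partialDeriv i)^[α i] h) (partialDeriv i f) := by
  induction l with
  | nil => rfl
  | cons j l ih =>
    exact (partialDeriv_iterate_comm i j _ (hf.foldr_partialDeriv α l)).trans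
      (iterate_partialDeriv_congr j _ ih)

/-- `multiDeriv` applies the derivatives in a fixed order, so the extra one has to be commuted past
those of the variables after `i` in the list, by the symmetry of second derivatives. -/
theorem multiDeriv_partialDeriv (i : Fin n) (α : Fin n →₀ ℕ) (hf : SmoothNearZero f) :
    multiDeriv α (partialDeriv i f) =ᶠ[𝓝 0] multiDeriv (α + Finsupp.single i 1) f := by
  have hnot : ∀ l : List (Fin n), i ∉ l →
      l.foldr (fun j h => (partialDeriv j)^[(α + Finsupp.single i 1 : Fin n →₀ ℕ) j] h) f =
        l.foldr (fun j h => (partialDeriv j)^[α j] h) f := by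
    intro l
    induction l with
    | nil => exact fun _ => rfl
    | cons j l ih =>
      intro hi
      rw [List.mem_cons, not_or] at hi
      rw [List.foldr_cons, List.foldr_cons, ih hi.2, Finsupp.add_apply,
        Finsupp.single_eq_of_ne (Ne.symm hi.1), add_zero]
  have hmem : ∀ l : List (Fin n), l.Nodup → i ∈ l →
      l.foldr (fun j h => (partialDeriv j)^[α j] h) (partialDeriv i f) =ᶠ[𝓝 0]
        l.foldr (fun j h =>
          (partialDeriv j)^[(α + Finsupp.single i 1 : Fin n →₀ ℕ) j] h) f := by
    intro l
    induction l with
    | nil => intro _ hi; cases hi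
    | cons j l ih =>
      intro hl hi
      rw [List.nodup_cons] at hl
      rw [List.foldr_cons, List.foldr_cons]
      by_cases hij : i = j
      · subst hij
        rw [hnot l hl.1, Finsupp.add_apply, Finsupp.single_eq_same, Function.iterate_succ_apply]
        exact iterate_partialDeriv_congr i _ (partialDeriv_foldr_comm i α l hf).symm
      · rw [Finsupp.add_apply, Finsupp.single_eq_of_ne (Ne.symm hij), add_zero]
        exact iterate_partialDeriv_congr j _
          (ih hl.2 ((List.mem_cons.mp hi).resolve_left hij))
  exact hmem _ (List.nodup_finRange n) (List.mem_finRange i)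

theorem taylorSeries_congr (h : f =ᶠ[𝓝 0] g) : taylorSeries f = taylorSeries g := by
  funext α
  simp only [taylorSeries, (multiDeriv_congr α h).self_of_nhds]

theorem coeff_taylorSeries (α : Fin n →₀ ℕ) (f : (Fin n → ℝ) → ℝ) :
    MvPowerSeries.coeff α (taylorSeries f) =
      multiDeriv α f 0 / (∏ i, (α i).factorial : ℕ) := rfl

theorem constantCoeff_taylorSeries (f : (Fin n → ℝ) → ℝ) :
    MvPowerSeries.constantCoeff (taylorSeries f) = f 0 := by
  have h : ∀ l : List (Fin n),
      l.foldr (fun i h => (partialDeriv i)^[(0 : Fin n →₀ ℕ) i] h) f = f := by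
    intro l
    induction l with
    | nil => rfl
    | cons j l ih => exact ih
  rw [← MvPowerSeries.coeff_zero_eq_constantCoeff_apply, coeff_taylorSeries, multiDeriv, h]
  simp

theorem pderiv_taylorSeries (i : Fin n) (hf : SmoothNearZero f) :
    MvPowerSeries.pderiv ℝ i (taylorSeries f) = taylorSeries (partialDeriv i f) := by
  ext α
  rw [MvPowerSeries.coeff_pderiv, coeff_taylorSeries, coeff_taylorSeries,
    (multiDeriv_partialDeriv i α hf).self_of_nhds]
  have hfac : (∏ j, ((α + Finsupp.single i 1 : Fin n →₀ ℕ) j).factorial) =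
      (α i + 1) * ∏ j, (α j).factorial := by
    rw [← Finset.mul_prod_erase _ _ (Finset.mem_univ i),
      ← Finset.mul_prod_erase _ (fun j => (α j).factorial) (Finset.mem_univ i), ← mul_assoc]
    congr 1
    · simp [Nat.factorial_succ]
    · refine Finset.prod_congr rfl fun j hj => ?_
      rw [Finsupp.add_apply, Finsupp.single_eq_of_ne (Finset.ne_of_mem_erase hj), add_zero]
  rw [hfac, Nat.cast_mul, Nat.cast_add_one]
  have h1 : (α i : ℝ) + 1 ≠ 0 := by positivity
  have h2 : ((∏ j, (α j).factorial : ℕ) : ℝ) ≠ 0 :=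
    Nat.cast_ne_zero.mpr (Finset.prod_ne_zero_iff.mpr fun j _ => (α j).factorial_ne_zero)
  field_simp

theorem exponent_induction {P : (Fin n →₀ ℕ) → Prop} (zero : P 0)
    (step : ∀ α i, P α → P (α + Finsupp.single i 1)) (α : Fin n →₀ ℕ) : P α := by
  have h : ∀ β : Fin n →₀ ℕ, ∀ α, P α → P (α + β) := by
    intro β
    induction β using Finsupp.induction_linear with
    | zero => exact fun α h => by rwa [add_zero]
    | add a b ha hb => exact fun α h => by rw [← add_assoc]; exact hb _ (ha _ h)
    | single i k =>
      induction k with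
      | zero => exact fun α h => by rwa [Finsupp.single_zero, add_zero]
      | succ k ih =>
        intro α h
        rw [Finsupp.single_add, ← add_assoc]
        exact step _ _ (ih _ h)
  simpa using h α 0 zero

/-- The inductive step for identities of Taylor series: coefficients are compared after
differentiating, which only introduces a nonzero integer factor. -/
theorem eq_of_coeff_pderiv_eq {p q : MvPowerSeries (Fin n) ℝ} {α : Fin n →₀ ℕ} {i : Fin n}
    (h : MvPowerSeries.coeff α (MvPowerSeries.pderiv ℝ i p) =
      MvPowerSeries.coeff α (MvPowerSeries.pderiv ℝ i q)) :
    MvPowerSeries.coeff (α + Finsupp.single i 1) p =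
      MvPowerSeries.coeff (α + Finsupp.single i 1) q := by
  rw [MvPowerSeries.coeff_pderiv, MvPowerSeries.coeff_pderiv] at h
  exact mul_right_cancel₀ (by positivity) h

theorem taylorSeries_add (hf : SmoothNearZero f) (hg : SmoothNearZero g) :
    taylorSeries (f + g) = taylorSeries f + taylorSeries g := by
  ext α
  induction α using exponent_induction generalizing f g with
  | zero =>
    simp only [MvPowerSeries.coeff_zero_eq_constantCoeff_apply, map_add,
      constantCoeff_taylorSeries, Pi.add_apply]
  | step α i ih =>
    apply eq_of_coeff_pderiv_eq
    rw [map_add (MvPowerSeries.pderiv ℝ i), pderiv_taylorSeries i (hf.add hg),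
      pderiv_taylorSeries i hf, pderiv_taylorSeries i hg,
      taylorSeries_congr (partialDeriv_add i hf hg), ih (hf.partialDeriv i) (hg.partialDeriv i)]

/-- Both sides obey the Leibniz rule and have the same constant term, so induction on the exponent,
for all pairs of functions at once, avoids a multivariate Leibniz formula. -/
theorem taylorSeries_mul (hf : SmoothNearZero f) (hg : SmoothNearZero g) :
    taylorSeries (f * g) = taylorSeries f * taylorSeries g := by
  ext α
  induction α using exponent_induction generalizing f g with
  | zero =>
    simp only [MvPowerSeries.coeff_zero_eq_constantCoeff_apply, map_mul,
      constantCoeff_taylorSeries, Pi.mul_apply]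
  | step α i ih =>
    apply eq_of_coeff_pderiv_eq
    rw [Derivation.leibniz, pderiv_taylorSeries i (hf.mul hg),
      pderiv_taylorSeries i hf, pderiv_taylorSeries i hg,
      taylorSeries_congr (partialDeriv_mul i hf hg),
      taylorSeries_add ((hf.partialDeriv i).mul hg) (hf.mul (hg.partialDeriv i)), map_add,
      ih (hf.partialDeriv i) hg, ih hf (hg.partialDeriv i), ← map_add]
    congr 1
    simp only [smul_eq_mul]
    ring

theorem taylorSeries_zero : taylorSeries (0 : (Fin n → ℝ) → ℝ) = 0 := by
  have h0 : SmoothNearZero (0 : (Fin n → ℝ) → ℝ) := contDiff_const.smoothNearZero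
  have h := taylorSeries_add h0 h0
  rw [add_zero] at h
  exact left_eq_add.mp h

theorem taylorSeries_const (c : ℝ) :
    taylorSeries (fun _ : Fin n → ℝ => c) = MvPowerSeries.C c := by
  refine MvPowerSeries.pderiv.ext (fun i => ?_) ?_
  · rw [pderiv_taylorSeries i contDiff_const.smoothNearZero, MvPowerSeries.pderiv_C,
      ← taylorSeries_zero]
    congr 1
    funext y
    simp [partialDeriv]
  · rw [constantCoeff_taylorSeries, MvPowerSeries.constantCoeff_C]

theorem taylorSeries_coord (j : Fin n) :
    taylorSeries (fun y : Fin n → ℝ => y j) = MvPowerSeries.X j := by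
  refine MvPowerSeries.pderiv.ext (fun i => ?_) ?_
  · have h : partialDeriv i (fun y : Fin n → ℝ => y j) = fun _ => if i = j then 1 else 0 := by
      funext y
      change fderiv ℝ (ContinuousLinearMap.proj (R := ℝ) (φ := fun _ : Fin n => ℝ) j) y _ = _
      rw [ContinuousLinearMap.fderiv, ContinuousLinearMap.proj_apply, Pi.single_apply]
      simp only [eq_comm]
    rw [pderiv_taylorSeries i (contDiff_apply ℝ ℝ j).smoothNearZero, h, taylorSeries_const]
    split_ifs with hij
    · rw [hij, MvPowerSeries.pderiv_X_self, map_one]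
    · rw [MvPowerSeries.pderiv_X_of_ne (Ne.symm hij), map_zero]
  · rw [constantCoeff_taylorSeries, MvPowerSeries.constantCoeff_X, Pi.zero_apply]

theorem taylorSeries_pow (hf : SmoothNearZero f) (k : ℕ) :
    SmoothNearZero (f ^ k) ∧ taylorSeries (f ^ k) = taylorSeries f ^ k := by
  induction k with
  | zero =>
    rw [pow_zero, pow_zero]
    exact ⟨contDiff_const.smoothNearZero, (taylorSeries_const 1).trans (map_one _)⟩
  | succ k ih =>
    rw [pow_succ, pow_succ, ← ih.2]
    exact ⟨ih.1.mul hf, taylorSeries_mul ih.1 hf⟩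

theorem taylorSeries_monomial (α : Fin n →₀ ℕ) (c : ℝ) :
    taylorSeries (fun y : Fin n → ℝ => c * ∏ i, y i ^ α i) = MvPowerSeries.monomial α c := by
  have h : ∀ s : Finset (Fin n), SmoothNearZero (fun y : Fin n → ℝ => ∏ i ∈ s, y i ^ α i) ∧
      taylorSeries (fun y : Fin n → ℝ => ∏ i ∈ s, y i ^ α i) =
        ∏ i ∈ s, MvPowerSeries.X i ^ α i := by
    classical
    intro s
    induction s using Finset.induction_on with
    | empty =>
      simp only [Finset.prod_empty]
      exact ⟨contDiff_const.smoothNearZero, (taylorSeries_const 1).trans (map_one _)⟩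
    | insert i s hi ih =>
      simp only [Finset.prod_insert hi]
      have hp := taylorSeries_pow (contDiff_apply ℝ ℝ i).smoothNearZero (α i)
      rw [← ih.2, ← taylorSeries_coord, ← hp.2]
      exact ⟨hp.1.mul ih.1, taylorSeries_mul hp.1 ih.1⟩
  have h1 := taylorSeries_mul (contDiff_const (c := c)).smoothNearZero (h Finset.univ).1
  rw [taylorSeries_const, (h Finset.univ).2] at h1
  refine h1.trans ?_
  have h2 := congrArg (MvPolynomial.toMvPowerSeries (σ := Fin n) (R := ℝ))
    (MvPolynomial.monomial_eq (s := α) (a := c))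
  rw [MvPolynomial.coe_monomial, MvPolynomial.coe_mul, MvPolynomial.coe_C] at h2
  rw [h2, Finsupp.prod_fintype _ _ (fun i => pow_zero _)]
  congr 1
  rw [← MvPolynomial.coeToMvPowerSeries.ringHom_apply, map_prod]
  simp

end TaylorSeries

/-! ### Borel's lemma -/

section Borel

variable {n : ℕ}

/-- Termwise differentiation of a series is used for `iteratedFDeriv`; the order and the directions
must not depend on `f`, so that they serve the sum and all its terms. -/
theorem exists_multiDeriv_eq_iteratedFDeriv (α : Fin n →₀ ℕ) :
    ∃ (k : ℕ) (v : Fin k → Fin n → ℝ), ∀ f : (Fin n → ℝ) → ℝ, ContDiff ℝ ∞ f →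
      multiDeriv α f = fun y => iteratedFDeriv ℝ k f y v := by
  have hstep : ∀ (i : Fin n) {k : ℕ} (v : Fin k → Fin n → ℝ) {f : (Fin n → ℝ) → ℝ},
      ContDiff ℝ ∞ f → partialDeriv i (fun y => iteratedFDeriv ℝ k f y v) =
        fun y => iteratedFDeriv ℝ (k + 1) f y (Fin.cons (Pi.single i 1) v) := by
    intro i k v f hf
    funext y
    have hd : DifferentiableAt ℝ (iteratedFDeriv ℝ k f) y :=
      hf.differentiable_iteratedFDeriv (mod_cast ENat.natCast_lt_top k) y
    rw [hd.iteratedFDeriv_succ_apply_left']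
    simp only [Fin.tail_cons, Fin.cons_zero]
    rfl
  have hiter : ∀ (i : Fin n) (m : ℕ) {k : ℕ} (v : Fin k → Fin n → ℝ),
      ∃ (k' : ℕ) (v' : Fin k' → Fin n → ℝ), ∀ f : (Fin n → ℝ) → ℝ, ContDiff ℝ ∞ f →
        (partialDeriv i)^[m] (fun y => iteratedFDeriv ℝ k f y v) =
          fun y => iteratedFDeriv ℝ k' f y v' := by
    intro i m
    induction m with
    | zero => exact fun v => ⟨_, v, fun f _ => rfl⟩
    | succ m ih =>
      intro k v
      obtain ⟨k', v', h⟩ := ih (Fin.cons (Pi.single i 1) v : Fin (k + 1) → Fin n → ℝ)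
      refine ⟨k', v', fun f hf => ?_⟩
      rw [Function.iterate_succ_apply, hstep i v hf, h f hf]
  unfold multiDeriv
  induction List.finRange n with
  | nil => exact ⟨0, Fin.elim0, fun f _ => by funext y; simp⟩
  | cons i l ih =>
    obtain ⟨k, v, h⟩ := ih
    obtain ⟨k', v', h'⟩ := hiter i (α i) v
    refine ⟨k', v', fun f hf => ?_⟩
    rw [List.foldr_cons, h f hf, h' f hf]

/-- Rescaling a compactly supported smooth function by a large factor makes its derivatives of
order less than `d` small. -/
theorem exists_rescaling_bounds {E : Type*} [NormedAddCommGroup E] [NormedSpace ℝ E]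
    {h : E → ℝ} (hh : ContDiff ℝ ∞ h) (hs : HasCompactSupport h) (d : ℕ) {ε : ℝ} (hε : 0 < ε) :
    ∃ t : ℝ, 1 ≤ t ∧ (∀ k, ∃ B, ∀ y,
      ‖iteratedFDeriv ℝ k (fun y => (t ^ d)⁻¹ * h (t • y)) y‖ ≤ B) ∧
      ∀ k < d, ∀ y, ‖iteratedFDeriv ℝ k (fun y => (t ^ d)⁻¹ * h (t • y)) y‖ ≤ ε := by
  have hbound : ∀ k : ℕ, ∃ M, ∀ y, ‖iteratedFDeriv ℝ k h y‖ ≤ M := fun k =>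
    (hs.iteratedFDeriv k).exists_bound_of_continuous
      (hh.continuous_iteratedFDeriv (mod_cast le_top))
  choose M hM using hbound
  have hM0 : ∀ k, 0 ≤ M k := fun k => (norm_nonneg _).trans (hM k 0)
  have hscale : ∀ t : ℝ, 1 ≤ t → ∀ k y,
      ‖iteratedFDeriv ℝ k (fun y => (t ^ d)⁻¹ * h (t • y)) y‖ ≤ (t ^ d)⁻¹ * (t ^ k * M k) := by
    intro t ht k y
    have ht0 : 0 ≤ t := zero_le_one.trans ht
    let L : E →L[ℝ] E := t • ContinuousLinearMap.id ℝ E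
    have hL : ‖L‖ ≤ t := by
      refine ContinuousLinearMap.opNorm_le_bound _ ht0 fun x => ?_
      change ‖t • x‖ ≤ _
      rw [norm_smul, Real.norm_of_nonneg ht0]
    have hcomp : ContDiff ℝ ∞ (h ∘ L) := hh.comp L.contDiff
    have h1 : (fun y => (t ^ d)⁻¹ * h (t • y)) = (t ^ d)⁻¹ • (h ∘ L) := rfl
    rw [h1, iteratedFDeriv_const_smul_apply (hcomp.of_le (mod_cast le_top)).contDiffAt, norm_smul,
      Real.norm_of_nonneg (by positivity), L.iteratedFDeriv_comp_right hh y (mod_cast le_top)]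
    gcongr
    refine (ContinuousMultilinearMap.norm_compContinuousLinearMap_le _ _).trans ?_
    rw [Finset.prod_const, Finset.card_univ, Fintype.card_fin, mul_comm]
    gcongr
    exact hM k _
  -- The `k`-th derivative is scaled by `t ^ k / t ^ d`, at most `1 / t` for `k < d`, so `t ≥ S / ε`
  -- suffices for all these `k` at once.
  let S := ∑ k ∈ Finset.range d, M k
  refine ⟨max 1 (S / ε), le_max_left _ _, fun k => ⟨_, hscale _ (le_max_left _ _) k⟩,
    fun k hk y => (hscale _ (le_max_left _ _) k y).trans ?_⟩
  set t := max 1 (S / ε)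
  have ht : 1 ≤ t := le_max_left _ _
  have ht0 : 0 < t := one_pos.trans_le ht
  have hMS : M k ≤ S :=
    Finset.single_le_sum (f := M) (fun j _ => hM0 j) (Finset.mem_range.mpr hk)
  have h2 : M k ≤ t * ε := hMS.trans ((div_le_iff₀ hε).mp (le_max_right _ _))
  rw [inv_mul_le_iff₀ (by positivity)]
  calc t ^ k * M k ≤ t ^ k * (t * ε) := by gcongr
    _ = t ^ (k + 1) * ε := by ring
    _ ≤ t ^ d * ε := by gcongr; exact hk

theorem finite_degree_le (k : ℕ) : {α : Fin n →₀ ℕ | α.degree ≤ k}.Finite := by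
  refine (Set.finite_Iic (Finsupp.equivFunOnFinite.symm fun _ : Fin n => k)).subset fun α hα i => ?_
  exact (Finsupp.le_degree i α).trans hα

/-- **Borel's lemma**: every formal power series is the Taylor series of a smooth function. -/
theorem exists_contDiff_taylorSeries_eq (p : MvPowerSeries (Fin n) ℝ) :
    ∃ f : (Fin n → ℝ) → ℝ, ContDiff ℝ ∞ f ∧ taylorSeries f = p := by
  classical
  let χ : ContDiffBump (0 : Fin n → ℝ) := ⟨1, 2, one_pos, one_lt_two⟩
  let h : (Fin n →₀ ℕ) → (Fin n → ℝ) → ℝ := fun α y =>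
    χ y * (MvPowerSeries.coeff α p * ∏ i, y i ^ α i)
  have hh : ∀ α, ContDiff ℝ ∞ (h α) := fun α => χ.contDiff.mul (by fun_prop)
  have hs : ∀ α, HasCompactSupport (h α) := fun α => χ.hasCompactSupport.mul_right
  obtain ⟨u, hu0, c, hu, -⟩ := posSumOfEncodable one_pos (Fin n →₀ ℕ)
  choose t ht hB hsmall using fun α => exists_rescaling_bounds (hh α) (hs α) α.degree (hu0 α)
  choose B hB using hB
  let F : (Fin n →₀ ℕ) → (Fin n → ℝ) → ℝ := fun α y =>
    (t α ^ α.degree)⁻¹ * h α (t α • y)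
  have hF : ∀ α, ContDiff ℝ ∞ (F α) := fun α =>
    contDiff_const.mul ((hh α).comp (contDiff_const_smul (t α)))
  -- For fixed `k` only finitely many `α` have degree at most `k`; all others are bounded by the
  -- summable `u`, so the large bounds `B α k` do no harm.
  let v : ℕ → (Fin n →₀ ℕ) → ℝ := fun k α => if k < α.degree then u α else B α k
  have hv : ∀ k, Summable (v k) := by
    intro k
    refine hu.summable.congr_cofinite ?_
    refine (finite_degree_le k).subset fun α hα => ?_
    by_contra hk
    exact hα (if_pos (not_le.mp hk)).symm
  have hFv : ∀ k α y, ‖iteratedFDeriv ℝ k (F α) y‖ ≤ v k α := by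
    intro k α y
    by_cases hk : k < α.degree
    · exact (hsmall α k hk y).trans_eq (if_pos hk).symm
    · exact (hB α k y).trans_eq (if_neg hk).symm
  have hjet : ∀ α, taylorSeries (F α) = MvPowerSeries.monomial α (MvPowerSeries.coeff α p) := by
    intro α
    rw [← taylorSeries_monomial]
    -- Near the origin the bump equals `1`, and the rescaling cancels because the monomial is
    -- homogeneous of degree `α.degree`.
    refine taylorSeries_congr ?_
    have ht0 : t α ≠ 0 := (one_pos.trans_le (ht α)).ne'
    have htend : Tendsto (fun y : Fin n → ℝ => t α • y) (𝓝 0) (𝓝 0) := by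
      have := (continuous_const_smul (t α) : Continuous fun y : Fin n → ℝ => t α • y).tendsto 0
      rwa [smul_zero] at this
    filter_upwards [htend.eventually χ.eventuallyEq_one] with y hy
    simp only [F, h]
    rw [hy]
    simp only [Pi.smul_apply, smul_eq_mul, mul_pow, Finset.prod_mul_distrib, Pi.one_apply, one_mul,
      Finset.prod_pow_eq_pow_sum]
    rw [← Finsupp.degree_eq_sum]
    field_simp
  refine ⟨fun y => ∑' α, F α y, contDiff_tsum hF (fun k _ => hv k) fun k α y _ => hFv k α y, ?_⟩
  ext β
  obtain ⟨k, w, hk⟩ := exists_multiDeriv_eq_iteratedFDeriv β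
  have hsum : Summable fun α => iteratedFDeriv ℝ k (F α) 0 :=
    Summable.of_norm_bounded (hv k) fun α => hFv k α 0
  rw [coeff_taylorSeries, hk _ (contDiff_tsum hF (fun k _ => hv k) fun k α y _ => hFv k α y)]
  simp only
  rw [iteratedFDeriv_tsum_apply hF (fun k _ => hv k) (fun k α y _ => hFv k α y)
    (mod_cast le_top)]
  have happly : (∑' α, iteratedFDeriv ℝ k (F α) 0) w = ∑' α, multiDeriv β (F α) 0 := by
    simp only [hk _ (hF _)]
    exact (ContinuousMultilinearMap.apply ℝ (fun _ : Fin k => Fin n → ℝ) ℝ w).map_tsum hsum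
  rw [happly, ← tsum_div_const]
  simp only [← coeff_taylorSeries, hjet]
  rw [tsum_eq_single β]
  · rw [MvPowerSeries.coeff_monomial_same]
  · intro α hα
    rw [MvPowerSeries.coeff_monomial_ne hα.symm]

end Borel

/-! ### The jet homomorphism for smooth germs -/

/-- The Taylor series as a ring homomorphism on smooth germs. -/
noncomputable def germJetHom (n : ℕ) : smoothGerms n →+* MvPowerSeries (Fin n) ℝ where
  toFun φ := germJet φ.1
  map_one' := (taylorSeries_const 1).trans (map_one _)
  map_zero' := taylorSeries_zero
  map_mul' := by
    rintro ⟨_, f, hf, rfl⟩ ⟨_, g, hg, rfl⟩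
    exact taylorSeries_mul hf hg
  map_add' := by
    rintro ⟨_, f, hf, rfl⟩ ⟨_, g, hg, rfl⟩
    exact taylorSeries_add hf hg

theorem isJetHom_smoothJet (n : ℕ) : (smoothJet n).IsJetHom (germJetHom n) where
  jet_eq := rfl
  surjective p := by
    obtain ⟨f, hf, hp⟩ := exists_contDiff_taylorSeries_eq p
    exact ⟨⟨Germ.ofFun f, f, hf.smoothNearZero, rfl⟩, hp⟩
  jet_term := taylorSeries_monomial
  term_add α β c d := by
    have h : (fun y : Fin n → ℝ => c * d * ∏ i, y i ^ (α + β) i) =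
        (fun y => c * ∏ i, y i ^ α i) * fun y => d * ∏ i, y i ^ β i := by
      funext y
      simp only [Pi.mul_apply, Finsupp.add_apply, pow_add, Finset.prod_mul_distrib]
      ring
    exact Subtype.ext (congrArg Germ.ofFun h)

end GermDivision

theorem mainTheorem2 (n : ℕ) (ord : LocalOrder n) :
    -- the ring of smooth germs
    (∀ (m : ℕ) (g : Fin m → smoothGerms n),
      (∀ f, ∃ r, (smoothJet n).IsRemainder ord g f r) ∧
      ((smoothJet n).IsStandardBasis ord g ↔
        ∀ f r r', (smoothJet n).IsRemainder ord g f r → (smoothJet n).IsRemainder ord g f r' →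
          (smoothJet n).Flat (r - r')) ∧
      ((smoothJet n).IsStandardBasis ord g ↔
        ∀ i j r, (smoothJet n).IsRemainder ord g ((smoothJet n).SGerm ord (g i) (g j)) r →
          (smoothJet n).Flat r) ∧
      ((smoothJet n).IsStandardBasis ord g ↔
        ∀ i j, ∃ r, (smoothJet n).IsRemainder ord g ((smoothJet n).SGerm ord (g i) (g j)) r ∧
          (smoothJet n).Flat r) ∧
      ((smoothJet n).IsStandardBasis ord g ↔
        ∀ f ∈ Ideal.span (Set.range g), ∀ r, (smoothJet n).IsRemainder ord g f r →
          (smoothJet n).Flat r) ∧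
      ((smoothJet n).IsStandardBasis ord g ↔
        ∀ f ∈ Ideal.span (Set.range g), ∃ r, (smoothJet n).IsRemainder ord g f r ∧
          (smoothJet n).Flat r)) ∧
    -- the ring of formal power series over a field of characteristic zero
    (∀ (K : Type*) [Field K] [CharZero K] (m : ℕ) (g : Fin m → MvPowerSeries (Fin n) K),
      (∀ f, ∃ r, (formalJet n K).IsRemainder ord g f r) ∧
      ((formalJet n K).IsStandardBasis ord g ↔
        ∀ f r r', (formalJet n K).IsRemainder ord g f r → (formalJet n K).IsRemainder ord g f r' →
          (formalJet n K).Flat (r - r')) ∧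
      ((formalJet n K).IsStandardBasis ord g ↔
        ∀ i j r, (formalJet n K).IsRemainder ord g ((formalJet n K).SGerm ord (g i) (g j)) r →
          (formalJet n K).Flat r) ∧
      ((formalJet n K).IsStandardBasis ord g ↔
        ∀ i j, ∃ r, (formalJet n K).IsRemainder ord g ((formalJet n K).SGerm ord (g i) (g j)) r ∧
          (formalJet n K).Flat r) ∧
      ((formalJet n K).IsStandardBasis ord g ↔
        ∀ f ∈ Ideal.span (Set.range g), ∀ r, (formalJet n K).IsRemainder ord g f r →
          (formalJet n K).Flat r) ∧
      ((formalJet n K).IsStandardBasis ord g ↔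
        ∀ f ∈ Ideal.span (Set.range g), ∃ r, (formalJet n K).IsRemainder ord g f r ∧
          (formalJet n K).Flat r)) := by
  exact ⟨fun _ g => (isJetHom_smoothJet n).division_and_criteria ord g,
    fun K _ _ _ g => (isJetHom_formalJet n K).division_and_criteria ord g⟩
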